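/- Let $R$ be a two-sided noetherian ring (not necessarily commutative); modules are right $R$-modules unless stated otherwise, and $(-)^*=\operatorname{Hom}_R(-,R)$. A finitely generated module $M$ is *Gorenstein projective* if $\operatorname{Ext}^j_R(M,R)=0$ and $\operatorname{Ext}^j_{R^{\mathrm{op}}}(\operatorname{Tr}M,R)=0$ for all $j\ge 1$, where $\operatorname{Tr}M=\operatorname{Coker}(P_0^*\to P_1^*)$ for a presentation $P_1\to P_0\to M\to 0$ of $M$ by finitely generated projective modules. The *Gorenstein dimension* $\operatorname{G-dim}_RM\in\mathbb N\cup\{\infty\}$ is the infimum of the integers $n\ge 0$ for which there is an exact sequence $0\to X_n\to\cdots\to X_0\to M\to 0$ with all $X_i$ Gorenstein projective. Let $\mathcal K(R)=\mathcal K(\operatorname{proj}R)$ be the homotopy category of (unbounded) complexes of finitely generated projective $R$-modules. Let $\operatorname{Add}R$ be the intersection of all full subcategories of $\mathcal K(R)$ that contain $R$ (as a complex in degree $0$) and are closed under shifts, direct summands and those coproducts that exist in $\mathcal K(R)$. A morphism $p:P\to X$ is a *right $\operatorname{Add}R$-approximation* if $P\in\operatorname{Add}R$ and every morphism $W\to X$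 with $W\in\operatorname{Add}R$ factors through $p$; then $\operatorname{Cone}(p)[-1]$ is called a *syzygy* $\Omega X$ of $X$. Put $\Omega^0X=X$ and $\Omega^{n}X=\Omega(\Omega^{n-1}X)$ for $n\ge1$. For $X\in\mathcal K(R)$ and $i\in\mathbb Z$ let $C^i(X)=\operatorname{Coker}(d_X^{i-1}:X^{i-1}\to X^i)$. The complex $X$ is *Gorenstein projective* if every module $C^i(X)$, $i\in\mathbb Z$, is Gorenstein projective. The *Gorenstein dimension* $\operatorname{G-dim}_RX\in\mathbb N\cup\{\infty\}$ is the infimum of the integers $n\ge0$ for which there are triangles $X_{i+1}\to G_i\xrightarrow{f_i}X_i\to X_{i+1}[1]$ in $\mathcal K(R)$, $0\le i\le n-1$, with $G_i$ Gorenstein projective and $\mathrm H^j(f_i)$ surjective for all $j\in\mathbb Z$, such that $X_0\cong X$ and $X_n$ is Gorenstein projective. **Theorem.** Let $X\in\mathcal K(R)$. 1. For every integer $n\ge 0$, an $n$th syzygy $\Omega^nX$ exists and, for every choice of approximations used to form $\Omega^nX$, one has $\operatorname{G-dim}_RX\le n$ if and only if $\Omega^nX$ is Gorenstein projective. 2.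 $\operatorname{G-dim}_RX=\sup\{\operatorname{G-dim}_RC^i(X)\mid i\in\mathbb Z\}$. -/

import Mathlib

open CategoryTheory CategoryTheory.Limits MulOpposite

universe u

noncomputable section

namespace GorensteinComplex

variable (R : Type u) [Ring R]

/-! ### Modules

Right `R`-modules are left `Rᵐᵒᵖ`-modules, left `R`-modules are `R`-modules. -/

/-- The property of a right `R`-module of being finitely generated and projective. -/
def isFGProj : ObjectProperty (ModuleCat.{u} Rᵐᵒᵖ) :=
  fun M => Module.Finite Rᵐᵒᵖ M ∧ Module.Projective Rᵐᵒᵖ M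

/-- The category `proj R` of finitely generated projective right `R`-modules. -/
abbrev ProjCat := (isFGProj R).FullSubcategory

variable {R}

/-- The transpose of a morphism `f : M ⟶ N` of right `R`-modules, i.e. the morphism of left
`R`-modules `Hom_R(N, R) ⟶ Hom_R(M, R)`, `g ↦ g ∘ f`. -/
def dualMap {M N : ModuleCat.{u} Rᵐᵒᵖ} (f : M ⟶ N) :
    ModuleCat.of R (N →ₗ[Rᵐᵒᵖ] R) ⟶ ModuleCat.of R (M →ₗ[Rᵐᵒᵖ] R) :=
  ModuleCat.ofHom (LinearMap.lcomp R R f.hom)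

/-- A finite projective presentation `P₁ ⟶ P₀ ⟶ M ⟶ 0` of a right `R`-module `M`. -/
structure FinProjPresentation (M : ModuleCat.{u} Rᵐᵒᵖ) where
  P₁ : ModuleCat.{u} Rᵐᵒᵖ
  P₀ : ModuleCat.{u} Rᵐᵒᵖ
  d₁ : P₁ ⟶ P₀
  d₀ : P₀ ⟶ M
  fgProj₁ : isFGProj R P₁
  fgProj₀ : isFGProj R P₀
  surjective : Function.Surjective d₀
  exact : Function.Exact d₁ d₀

/-- The Auslander transpose `Tr M = Coker(d₁^* : P₀^* ⟶ P₁^*)`, a left `R`-module, computed from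
a finite projective presentation of `M`. -/
def FinProjPresentation.tr {M : ModuleCat.{u} Rᵐᵒᵖ} (π : FinProjPresentation M) :
    ModuleCat.{u} R :=
  cokernel (dualMap π.d₁)

/-- A finitely generated right `R`-module `M` is Gorenstein projective if
`Ext^j_R(M, R) = 0` and `Ext^j_{R^op}(Tr M, R) = 0` for all `j ≥ 1`. The left module `Tr M` does
not depend on the presentation up to projective summands, so that the second condition does
not depend on the presentation either. -/
def IsGorensteinProjective (M : ModuleCat.{u} Rᵐᵒᵖ) : Prop :=
  Module.Finite Rᵐᵒᵖ M ∧
  (∀ j : ℕ, 1 ≤ j → Subsingleton (Abelian.Ext M (ModuleCat.of Rᵐᵒᵖ R) j)) ∧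
  ∃ π : FinProjPresentation M,
    ∀ j : ℕ, 1 ≤ j → Subsingleton (Abelian.Ext π.tr (ModuleCat.of R R) j)

/-- There is an exact sequence `0 ⟶ X_n ⟶ ⋯ ⟶ X_1 ⟶ X_0 ⟶ M ⟶ 0` of right `R`-modules with
every `X_i` (finitely generated) Gorenstein projective. -/
def HasModuleGorensteinResolution (n : ℕ) (M : ModuleCat.{u} Rᵐᵒᵖ) : Prop :=
  ∃ (X : ℕ → ModuleCat.{u} Rᵐᵒᵖ) (d : ∀ i, X (i + 1) ⟶ X i) (ε : X 0 ⟶ M),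
    (∀ i ≤ n, IsGorensteinProjective (X i)) ∧ (∀ i > n, Subsingleton (X i)) ∧
    Function.Surjective ε ∧ Function.Exact (d 0) ε ∧
    ∀ i, Function.Exact (d (i + 1)) (d i)

/-- The Gorenstein dimension of a right `R`-module, with value `⊤` if there is no
finite resolution by Gorenstein projective modules. -/
def moduleGdim (M : ModuleCat.{u} Rᵐᵒᵖ) : ℕ∞ :=
  sInf {m : ℕ∞ | ∃ n : ℕ, m = n ∧ HasModuleGorensteinResolution n M}

/-! ### The homotopy category `K(proj R)` -/

variable (R)

instance : (isFGProj R).ContainsZero where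
  exists_zero := ⟨ModuleCat.of Rᵐᵒᵖ PUnit.{u + 1}, ModuleCat.isZero_of_subsingleton _,
    (inferInstance : Module.Finite Rᵐᵒᵖ PUnit.{u + 1}),
    (inferInstance : Module.Projective Rᵐᵒᵖ PUnit.{u + 1})⟩

instance : (isFGProj R).IsClosedUnderIsomorphisms where
  of_iso e h :=
    ⟨@Module.Finite.equiv _ _ _ _ _ _ _ _ h.1 e.toLinearEquiv,
      @Module.Projective.of_equiv' _ _ _ _ _ _ _ _ h.2 e.toLinearEquiv⟩

instance : (isFGProj R).IsClosedUnderLimitsOfShape (Discrete WalkingPair) where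
  limitsOfShape_le := by
    rintro Y ⟨p⟩
    have hp := p.prop_diag_obj
    have h₁ := hp ⟨WalkingPair.left⟩
    have h₂ := hp ⟨WalkingPair.right⟩
    have e : Y ≅ ModuleCat.of Rᵐᵒᵖ
        (p.diag.obj ⟨WalkingPair.left⟩ × p.diag.obj ⟨WalkingPair.right⟩) :=
      p.isLimit.conePointUniqueUpToIso (limit.isLimit _) ≪≫
        HasLimit.isoOfNatIso (diagramIsoPair p.diag) ≪≫
        (biprod.isoProd _ _).symm ≪≫ ModuleCat.biprodIsoProd _ _
    have := h₁.1
    have := h₁.2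
    have := h₂.1
    have := h₂.2
    exact (isFGProj R).prop_of_iso e.symm
      ⟨Module.Finite.prod, (inferInstance : Module.Projective Rᵐᵒᵖ (_ × _))⟩

instance : HasBinaryProducts (ProjCat R) := inferInstance

instance : HasBinaryBiproducts (ProjCat R) := HasBinaryBiproducts.of_hasBinaryProducts

/-- The homotopy category `K(proj R)` of (unbounded) complexes of finitely generated projective
right `R`-modules, with Mathlib's triangulated structure. -/
abbrev KProj := HomotopyCategory (ProjCat R) (ComplexShape.up ℤ)

/-- The `i`th cohomology functor `H^i : K(proj R) ⥤ Mod R`. -/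
def cohomology (i : ℤ) : KProj R ⥤ ModuleCat.{u} Rᵐᵒᵖ :=
  (isFGProj R).ι.mapHomotopyCategory (ComplexShape.up ℤ) ⋙
    HomotopyCategory.homologyFunctor (ModuleCat.{u} Rᵐᵒᵖ) (ComplexShape.up ℤ) i

variable {R}

/-- The right `R`-module `C^i(X) = Coker(d^{i-1} : X^{i-1} ⟶ X^i)`. -/
def coker (X : KProj R) (i : ℤ) : ModuleCat.{u} Rᵐᵒᵖ :=
  cokernel (X.as.d (i - 1) i).hom

/-- A morphism in `K(proj R)` is cohomologically surjective if it induces surjections on all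
cohomology modules. -/
def CohSurjective {X Y : KProj R} (f : X ⟶ Y) : Prop :=
  ∀ i : ℤ, Function.Surjective ((cohomology R i).map f)

variable (R)

/-- `R` as an object of `proj R`. -/
def ringObj : ProjCat R :=
  ⟨ModuleCat.of Rᵐᵒᵖ R,
    Module.Finite.equiv (MulOpposite.opLinearEquiv Rᵐᵒᵖ (M := R)).symm,
    Module.Projective.of_equiv' (MulOpposite.opLinearEquiv Rᵐᵒᵖ (M := R)).symm⟩

/-- `R` as a complex concentrated in degree `0`. -/
def ringComplex : KProj R :=
  (HomotopyCategory.quotient _ _).obj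
    ((HomologicalComplex.single (ProjCat R) (ComplexShape.up ℤ) 0).obj (ringObj R))

variable {R}

/-- The closure conditions in the definition of `Add R`: a class of objects of `K(proj R)` that
contains `R` and is closed under shifts, direct summands, and those coproducts that exist in
`K(proj R)`. -/
structure IsAddClosed (𝒳 : ObjectProperty (KProj R)) : Prop where
  ring : 𝒳 (ringComplex R)
  shift : ∀ (X : KProj R) (i : ℤ), 𝒳 X → 𝒳 (X⟦i⟧)
  summand : ∀ X Y : KProj R, Nonempty (Retract X Y) → 𝒳 Y → 𝒳 X
  coproduct : ∀ (J : Type u) (F : J → KProj R) (c : Cofan F), Nonempty (IsColimit c) →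
    (∀ j, 𝒳 (F j)) → 𝒳 c.pt

variable (R) in
/-- `Add R`, the intersection of all the full subcategories of `K(proj R)` that contain `R` and are
closed under shifts, direct summands and existing coproducts. -/
def AddR : ObjectProperty (KProj R) :=
  fun X => ∀ 𝒳 : ObjectProperty (KProj R), IsAddClosed 𝒳 → 𝒳 X

/-- Right `Add R`-approximations. -/
def IsRightAddApproximation {P X : KProj R} (p : P ⟶ X) : Prop :=
  AddR R P ∧ ∀ W : KProj R, AddR R W → ∀ g : W ⟶ X, ∃ t : W ⟶ P, t ≫ p = g

/-- `Y` is a syzygy of `X`, i.e. `Y ≅ Cone(p)[-1]` for some right `Add R`-approximation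
`p : P ⟶ X`; equivalently, `Y` fits in a distinguished triangle `Y ⟶ P ⟶ X ⟶ Y[1]` on `p`. -/
def IsSyzygy (X Y : KProj R) : Prop :=
  ∃ (P : KProj R) (a : Y ⟶ P) (p : P ⟶ X) (h : X ⟶ Y⟦(1 : ℤ)⟧),
    IsRightAddApproximation p ∧ Pretriangulated.Triangle.mk a p h ∈ distTriang (KProj R)

/-- `Y` is an `n`th syzygy `Ω^n X` of `X`, for some choice of approximations;
`Ω^0 X = X` and `Ω^{n+1} X = Ω(Ω^n X)`. -/
def IsNthSyzygy : ℕ → KProj R → KProj R → Prop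
  | 0, X, Y => Nonempty (Y ≅ X)
  | n + 1, X, Y => ∃ Z : KProj R, IsNthSyzygy n X Z ∧ IsSyzygy Z Y

/-- A complex `X` in `K(proj R)` is Gorenstein projective if all the modules `C^i(X)` are. -/
def IsGorensteinProjectiveComplex (X : KProj R) : Prop :=
  ∀ i : ℤ, IsGorensteinProjective (coker X i)

/-- There are triangles `X_{i+1} ⟶ G_i ⟶ X_i ⟶ X_{i+1}[1]`, `0 ≤ i ≤ n - 1`, with `G_i` Gorenstein
projective and `G_i ⟶ X_i` cohomologically surjective, such that `X_0 ≅ X` and `X_n` is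
Gorenstein projective. -/
def HasGorensteinResolution (n : ℕ) (X : KProj R) : Prop :=
  ∃ Y G : ℕ → KProj R,
    Nonempty (Y 0 ≅ X) ∧ IsGorensteinProjectiveComplex (Y n) ∧
    ∀ i < n, IsGorensteinProjectiveComplex (G i) ∧
      ∃ (a : Y (i + 1) ⟶ G i) (f : G i ⟶ Y i) (h : Y i ⟶ (Y (i + 1))⟦(1 : ℤ)⟧),
        Pretriangulated.Triangle.mk a f h ∈ distTriang (KProj R) ∧ CohSurjective f

/-- The Gorenstein dimension of a complex in `K(proj R)`, with value `⊤` if there is no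
finite resolution. -/
def Gdim (X : KProj R) : ℕ∞ :=
  sInf {m : ℕ∞ | ∃ n : ℕ, m = n ∧ HasGorensteinResolution n X}

end GorensteinComplex

end

/-! Everything reduces to the modules $C^i(X)$. Let $Y\to G\to X\to Y[1]$ be a triangle whose map
$G\to X$ is surjective on cohomology. Replacing $X$ by the mapping cone $Z$ of a chain map
representing $Y\to G$, one finds in each degree a short exact sequence $0\to C^i(Y)\to C^i(G)\oplus
Y^{i+1}\to C^i(Z)\to 0$ (`exists_isShortExact_coker`). Homotopy equivalences change $C^i$ only up to
finitely generated projective summands. So if the modules $C^i(G)$ are Gorenstein projective, then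
$C^i(X)$ has dimension at most $n+1$ exactly when $C^i(Y)$ has dimension at most $n$. Iterating,
both $\operatorname{G-dim}X\le n$ and Gorenstein projectivity of $\Omega^nX$ say that every $C^i(X)$
has dimension at most $n$.

Syzygies fit this pattern because right $\operatorname{Add}R$-approximations are surjective on
cohomology. Objects of $\operatorname{Add}R$ lift through all cohomologically surjective maps, since
this property, required of all shifts, is closed under the defining operations. Conversely, cocycles
are finitely generated, so some complex $\coprod_i R^{n_i}[-i]$ maps onto the cohomology of $X$; it
is a coproduct in $\mathcal K(R)$ and lies in $\operatorname{Add}R$, and any approximation must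
factor this map.

For modules, the condition on $\operatorname{Tr}M$ is traded for coresolutions: $M$ is Gorenstein
projective iff for every $n$ it admits $n$ coresolution steps by finitely generated projectives with
$\operatorname{Ext}^{\ge1}(-,R)=0$ throughout (`isGorensteinProjective_iff`). In this form closure
under extensions and retracts is proved by induction on $n$, and the theory of dimension through
syzygies (`GdimLE`) follows. -/

noncomputable section

namespace GorensteinComplex

/-! ### Short exact sequences and vanishing of Ext -/

section Ext

variable {S : Type u} [Ring S]
variable {A B C : Type u} [AddCommGroup A] [AddCommGroup B] [AddCommGroup C]
  [Module S A] [Module S B] [Module S C]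

/-- A short exact sequence `0 → A → B → C → 0` of modules. -/
structure IsShortExact (f : A →ₗ[S] B) (g : B →ₗ[S] C) : Prop where
  inj : Function.Injective f
  exact : Function.Exact f g
  surj : Function.Surjective g

lemma IsShortExact.apply_apply {f : A →ₗ[S] B} {g : B →ₗ[S] C} (h : IsShortExact f g) (a : A) :
    g (f a) = 0 :=
  (h.exact _).2 ⟨a, rfl⟩

lemma IsShortExact.shortExact {f : A →ₗ[S] B} {g : B →ₗ[S] C} (h : IsShortExact f g) :
    (ModuleCat.shortComplexOfCompEqZero f g h.exact.linearMap_comp_eq_zero).ShortExact :=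
  ModuleCat.shortComplex_shortExact _ h.exact h.inj h.surj

lemma isShortExact_ker {g : B →ₗ[S] C} (hg : Function.Surjective g) :
    IsShortExact (LinearMap.ker g).subtype g where
  inj := Subtype.val_injective
  exact x := by simp
  surj := hg

lemma isShortExact_mkQ {f : A →ₗ[S] B} (hf : Function.Injective f) :
    IsShortExact f (LinearMap.range f).mkQ where
  inj := hf
  exact x := by simp
  surj := Submodule.mkQ_surjective _

lemma IsShortExact.exists_lift {f : A →ₗ[S] B} {g : B →ₗ[S] C} (h : IsShortExact f g)
    {D : Type u} [AddCommGroup D] [Module S D] (φ : D →ₗ[S] B) (hφ : ∀ x, g (φ x) = 0) :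
    ∃ ψ : D →ₗ[S] A, ∀ x, f (ψ x) = φ x := by
  have key : ∀ x, ∃ a, f a = φ x := fun x => (h.exact _).1 (hφ x)
  choose ψ hψ using key
  exact ⟨{ toFun := ψ
           map_add' := fun x y => h.inj (by simp [hψ])
           map_smul' := fun r x => h.inj (by simp [hψ]) }, hψ⟩

lemma IsShortExact.exists_desc {f : A →ₗ[S] B} {g : B →ₗ[S] C} (h : IsShortExact f g)
    {D : Type u} [AddCommGroup D] [Module S D] (φ : B →ₗ[S] D) (hφ : ∀ x, φ (f x) = 0) :
    ∃ ψ : C →ₗ[S] D, ∀ x, ψ (g x) = φ x := by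
  have key : ∀ c, ∃ b, g b = c := h.surj
  have wd : ∀ b b', g b = g b' → φ b = φ b' := by
    intro b b' hb
    obtain ⟨a, ha⟩ := (h.exact (b - b')).1 (by simp [hb])
    rw [← sub_eq_zero, ← map_sub, ← ha, hφ]
  choose s hs using key
  refine ⟨{ toFun := fun c => φ (s c)
            map_add' := fun x y => ?_
            map_smul' := fun r x => ?_ }, fun x => wd _ _ (hs _)⟩
  · rw [← map_add]; exact wd _ _ (by simp [hs])
  · rw [RingHom.id_apply, ← map_smul]; exact wd _ _ (by simp [hs])

variable (T : Type u) [AddCommGroup T] [Module S T]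

variable (S A) in
/-- `Ext^j_S(A, T) = 0`. -/
def ExtZero (j : ℕ) : Prop :=
  Subsingleton (Abelian.Ext (ModuleCat.of S A) (ModuleCat.of S T) j)

variable {T}

lemma extZero_of_projective [Module.Projective S A] (j : ℕ) : ExtZero S A T (j + 1) :=
  Abelian.Ext.subsingleton_of_projective _ _ _

lemma ExtZero.of_retract {j : ℕ} (h : ExtZero S B T j) (i : A →ₗ[S] B) (r : B →ₗ[S] A)
    (hri : ∀ x, r (i x) = x) : ExtZero S A T j := by
  refine subsingleton_of_forall_eq 0 fun x => ?_
  have e : ModuleCat.ofHom i ≫ ModuleCat.ofHom r = 𝟙 (ModuleCat.of S A) := by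
    ext x; exact hri x
  have h0 : (Abelian.Ext.mk₀ (ModuleCat.ofHom r)).comp x (zero_add j) = 0 :=
    h.elim _ _
  have := congrArg (fun y => (Abelian.Ext.mk₀ (ModuleCat.ofHom i)).comp y (zero_add j)) h0
  simpa [Abelian.Ext.mk₀_comp_mk₀_assoc, e] using this

lemma ExtZero.of_equiv {j : ℕ} (h : ExtZero S B T j) (e : A ≃ₗ[S] B) : ExtZero S A T j :=
  h.of_retract e.toLinearMap e.symm.toLinearMap (by simp)

namespace IsShortExact

variable {f : A →ₗ[S] B} {g : B →ₗ[S] C}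

lemma extZero_middle (h : IsShortExact f g) {j : ℕ} (hA : ExtZero S A T j)
    (hC : ExtZero S C T j) : ExtZero S B T j := by
  refine subsingleton_of_forall_eq 0 fun x => ?_
  obtain ⟨y, rfl⟩ := Abelian.Ext.contravariant_sequence_exact₂ h.shortExact _ x (hA.elim _ _)
  rw [hC.elim y 0, Abelian.Ext.comp_zero]

lemma extZero_left (h : IsShortExact f g) {j : ℕ} (hB : ExtZero S B T j)
    (hC : ExtZero S C T (j + 1)) : ExtZero S A T j := by
  refine subsingleton_of_forall_eq 0 fun x => ?_
  obtain ⟨y, rfl⟩ := Abelian.Ext.contravariant_sequence_exact₁ h.shortExact _ x (add_comm 1 j)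
    (hC.elim _ _)
  rw [hB.elim y 0, Abelian.Ext.comp_zero]

lemma extZero_right (h : IsShortExact f g) {j : ℕ} (hA : ExtZero S A T j)
    (hB : ExtZero S B T (j + 1)) : ExtZero S C T (j + 1) := by
  refine subsingleton_of_forall_eq 0 fun x => ?_
  obtain ⟨y, rfl⟩ := Abelian.Ext.contravariant_sequence_exact₃ h.shortExact _ x (hB.elim _ _)
    (add_comm 1 j)
  rw [hA.elim y 0, Abelian.Ext.comp_zero]

lemma exists_extend (h : IsShortExact f g) (hC : ExtZero S C T 1) (φ : A →ₗ[S] T) :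
    ∃ ψ : B →ₗ[S] T, ∀ x, ψ (f x) = φ x := by
  obtain ⟨y, hy⟩ := Abelian.Ext.contravariant_sequence_exact₁ h.shortExact (ModuleCat.of S T)
    (Abelian.Ext.mk₀ (ModuleCat.ofHom φ)) (add_comm 1 0) (hC.elim _ _)
  obtain ⟨ψ, rfl⟩ := (Abelian.Ext.mk₀_bijective _ _).2 y
  rw [Abelian.Ext.mk₀_comp_mk₀] at hy
  have := (Abelian.Ext.mk₀_bijective _ _).1 hy
  exact ⟨ψ.hom, fun x => congrArg (fun k => k.hom x) this⟩

/-- Since $\operatorname{Ext}^1(B,T)=0$, every class in $\operatorname{Ext}^1(C,T)$ comes from a map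
$A\to T$ by the connecting map, which kills maps that extend to $B$. -/
lemma extZero_one (h : IsShortExact f g) (hB : ExtZero S B T 1)
    (hext : ∀ φ : A →ₗ[S] T, ∃ ψ : B →ₗ[S] T, ∀ x, ψ (f x) = φ x) : ExtZero S C T 1 := by
  refine subsingleton_of_forall_eq 0 fun x => ?_
  obtain ⟨y, rfl⟩ := Abelian.Ext.contravariant_sequence_exact₃ h.shortExact _ x (hB.elim _ _)
    (add_comm 1 0)
  obtain ⟨φ, rfl⟩ := (Abelian.Ext.mk₀_bijective _ _).2 y
  obtain ⟨ψ, hψ⟩ := hext φ.hom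
  have : φ = (ModuleCat.shortComplexOfCompEqZero f g h.exact.linearMap_comp_eq_zero).f ≫
      ModuleCat.ofHom ψ := by
    ext x; exact (hψ x).symm
  rw [this, ← Abelian.Ext.mk₀_comp_mk₀, ← Abelian.Ext.comp_assoc_of_second_deg_zero,
    h.shortExact.extClass_comp, Abelian.Ext.zero_comp]

end IsShortExact

end Ext

/-! ### Duality for finitely generated projectives and the transpose -/

section Duality

variable {R : Type u} [Ring R]
variable {M N P Q P₁ : Type u} [AddCommGroup M] [Module Rᵐᵒᵖ M] [AddCommGroup N] [Module Rᵐᵒᵖ N]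
  [AddCommGroup P] [Module Rᵐᵒᵖ P] [AddCommGroup Q] [Module Rᵐᵒᵖ Q]
  [AddCommGroup P₁] [Module Rᵐᵒᵖ P₁]

/-- A finitely generated projective right module has a finite dual basis. -/
lemma exists_dual_basis (P : Type u) [AddCommGroup P] [Module Rᵐᵒᵖ P]
    [Module.Finite Rᵐᵒᵖ P] [Module.Projective Rᵐᵒᵖ P] :
    ∃ (n : ℕ) (p : Fin n → P) (f : Fin n → P →ₗ[Rᵐᵒᵖ] R),
      ∀ x, ∑ k, op (f k x) • p k = x := by
  obtain ⟨n, π, hπ⟩ := Module.Finite.exists_fin' Rᵐᵒᵖ P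
  obtain ⟨s, hs⟩ := Module.projective_lifting_property π LinearMap.id hπ
  refine ⟨n, fun k => π (Pi.single k 1), fun k =>
    (MulOpposite.opLinearEquiv Rᵐᵒᵖ (M := R)).symm.toLinearMap ∘ₗ LinearMap.proj k ∘ₗ s,
    fun x => ?_⟩
  have : π (s x) = x := LinearMap.congr_fun hs x
  conv_rhs => rw [← this, ← LinearMap.sum_single_apply (φ := fun _ : Fin n => Rᵐᵒᵖ) (s x), map_sum]
  refine Finset.sum_congr rfl fun k _ => ?_
  rw [← map_smul]
  congr 1
  ext l
  by_cases h : l = k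
  · subst h; simp
  · simp [h]

/-- The transpose of a linear map of right modules. -/
def dualL (f : M →ₗ[Rᵐᵒᵖ] N) : (N →ₗ[Rᵐᵒᵖ] R) →ₗ[R] (M →ₗ[Rᵐᵒᵖ] R) :=
  LinearMap.lcomp R R f

@[simp]
lemma dualL_apply (f : M →ₗ[Rᵐᵒᵖ] N) (φ : N →ₗ[Rᵐᵒᵖ] R) (x : M) : dualL f φ x = φ (f x) := rfl

lemma projective_dual (P : Type u) [AddCommGroup P] [Module Rᵐᵒᵖ P]
    [Module.Finite Rᵐᵒᵖ P] [Module.Projective Rᵐᵒᵖ P] :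
    Module.Projective R (P →ₗ[Rᵐᵒᵖ] R) := by
  obtain ⟨n, p, f, hpf⟩ := exists_dual_basis (R := R) P
  let i : (P →ₗ[Rᵐᵒᵖ] R) →ₗ[R] (Fin n → R) :=
    { toFun := fun φ k => φ (p k)
      map_add' := fun _ _ => rfl
      map_smul' := fun _ _ => rfl }
  let r : (Fin n → R) →ₗ[R] (P →ₗ[Rᵐᵒᵖ] R) := Fintype.linearCombination R f
  refine Module.Projective.of_split i r ?_
  ext φ x
  conv_rhs => rw [LinearMap.id_apply, ← hpf x, map_sum]
  simp [i, r, Fintype.linearCombination_apply, LinearMap.sum_apply]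

/-- Surjectivity of $P\to P^{**}$, from the expansion $\varphi=\sum_k\varphi(p_k)f_k$ in a dual
basis; `eq_of_forall_dual` is the injectivity. -/
lemma exists_eval_eq [Module.Finite Rᵐᵒᵖ P] [Module.Projective Rᵐᵒᵖ P]
    (θ : (P →ₗ[Rᵐᵒᵖ] R) →ₗ[R] R) : ∃ p : P, ∀ φ, θ φ = φ p := by
  obtain ⟨n, p, f, hpf⟩ := exists_dual_basis (R := R) P
  refine ⟨∑ k, op (θ (f k)) • p k, fun φ => ?_⟩
  have : φ = ∑ k, φ (p k) • f k := by
    ext x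
    conv_lhs => rw [← hpf x, map_sum]
    simp [LinearMap.sum_apply]
  conv_lhs => rw [this, map_sum]
  simp

lemma eq_of_forall_dual [Module.Finite Rᵐᵒᵖ P] [Module.Projective Rᵐᵒᵖ P] {x y : P}
    (h : ∀ φ : P →ₗ[Rᵐᵒᵖ] R, φ x = φ y) : x = y := by
  obtain ⟨n, p, f, hpf⟩ := exists_dual_basis (R := R) P
  rw [← hpf x, ← hpf y]
  simp [h]

lemma finite_dual [IsNoetherianRing R] (M : Type u) [AddCommGroup M] [Module Rᵐᵒᵖ M]
    [Module.Finite Rᵐᵒᵖ M] : Module.Finite R (M →ₗ[Rᵐᵒᵖ] R) := by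
  obtain ⟨n, π, hπ⟩ := Module.Finite.exists_fin' Rᵐᵒᵖ M
  let i : (M →ₗ[Rᵐᵒᵖ] R) →ₗ[R] (Fin n → R) :=
    { toFun := fun φ k => φ (π (Pi.single k 1))
      map_add' := fun _ _ => rfl
      map_smul' := fun _ _ => rfl }
  refine Module.Finite.of_injective i fun φ ψ h => ?_
  have : φ ∘ₗ π = ψ ∘ₗ π := by
    ext k
    simpa [i] using congrFun h k
  ext x
  obtain ⟨y, rfl⟩ := hπ x
  exact LinearMap.congr_fun this y

/-- The Auslander transpose of a map `d` of right modules, as a quotient. -/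
abbrev Transpose (d : P₁ →ₗ[Rᵐᵒᵖ] P) : Type u :=
  (P₁ →ₗ[Rᵐᵒᵖ] R) ⧸ LinearMap.range (dualL (R := R) d)

lemma isShortExact_transpose (d : P₁ →ₗ[Rᵐᵒᵖ] P) :
    IsShortExact (A := LinearMap.range (dualL (R := R) d)) (B := P₁ →ₗ[Rᵐᵒᵖ] R)
      (C := Transpose (R := R) d) (LinearMap.range (dualL (R := R) d)).subtype
      (LinearMap.range (dualL (R := R) d)).mkQ where
  inj := Subtype.val_injective
  exact x := by simp
  surj := Submodule.mkQ_surjective _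

/-- The transpose of a coresolution step is a first syzygy of the transpose. -/
lemma extZero_transpose_comp_iff {d₁ : P₁ →ₗ[Rᵐᵒᵖ] P} {d₀ : P →ₗ[Rᵐᵒᵖ] M}
    [Module.Finite Rᵐᵒᵖ P₁] [Module.Projective Rᵐᵒᵖ P₁]
    (hex : Function.Exact d₁ d₀) (hsurj : Function.Surjective d₀) (s : M →ₗ[Rᵐᵒᵖ] Q)
    (hs : ∀ φ : M →ₗ[Rᵐᵒᵖ] R, ∃ ψ : Q →ₗ[Rᵐᵒᵖ] R, ∀ x, ψ (s x) = φ x) (j : ℕ) :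
    ExtZero R (Transpose (R := R) (s ∘ₗ d₀)) R (j + 1) ↔
      ExtZero R (Transpose (R := R) d₁) R (j + 2) := by
  -- A functional killing the image of `d₁` descends to `M` and then extends along `s`. Hence the
  -- transpose of `s ∘ d₀` is the image of $d_1^*$ in the projective $P_1^*$, whose quotient is the
  -- transpose of `d₁`.
  have hker : LinearMap.range (dualL (R := R) (s ∘ₗ d₀)) = LinearMap.ker (dualL (R := R) d₁) := by
    ext ψ
    simp only [LinearMap.mem_range, LinearMap.mem_ker]
    constructor
    · rintro ⟨χ, rfl⟩
      ext x
      simp [(hex _).2 ⟨x, rfl⟩]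
    · intro hψ
      have h' : ∀ x ∈ LinearMap.ker d₀, ψ x = 0 := by
        intro x hx
        obtain ⟨y, rfl⟩ := (hex x).1 hx
        exact LinearMap.congr_fun hψ y
      obtain ⟨φ, hφ⟩ := (isShortExact_ker hsurj).exists_desc ψ fun x => h' _ x.2
      obtain ⟨χ, hχ⟩ := hs φ
      exact ⟨χ, by ext x; simp [hχ, hφ]⟩
  let e : Transpose (R := R) (s ∘ₗ d₀) ≃ₗ[R] LinearMap.range (dualL (R := R) d₁) :=
    (Submodule.quotEquivOfEq _ _ hker).trans (dualL d₁).quotKerEquivRange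
  have := projective_dual (R := R) P₁
  constructor
  · intro h
    exact (isShortExact_transpose d₁).extZero_right (h.of_equiv e.symm) (extZero_of_projective _)
  · intro h
    exact ((isShortExact_transpose d₁).extZero_left (extZero_of_projective _) h).of_equiv e

/-- Auslander's observation that $\operatorname{Ext}^1(\operatorname{Tr}M,R)$ is the kernel of $M\to
M^{**}$. A functional on $\operatorname{im}d_1^*$ pulls back to evaluation at some $p\in P$ with
$d_0p$ killed by $M^*$; it extends to $P_1^*$, where it is evaluation at some $q$, exactly when
$p=d_1q$ for that $q$. -/
lemma extZero_transpose_one_iff {d₁ : P₁ →ₗ[Rᵐᵒᵖ] P} {d₀ : P →ₗ[Rᵐᵒᵖ] M}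
    [Module.Finite Rᵐᵒᵖ P₁] [Module.Projective Rᵐᵒᵖ P₁]
    [Module.Finite Rᵐᵒᵖ P] [Module.Projective Rᵐᵒᵖ P]
    (hex : Function.Exact d₁ d₀) (hsurj : Function.Surjective d₀) :
    ExtZero R (Transpose (R := R) d₁) R 1 ↔
      ∀ m : M, (∀ φ : M →ₗ[Rᵐᵒᵖ] R, φ m = 0) → m = 0 := by
  constructor
  · intro h m hm
    obtain ⟨p, rfl⟩ := hsurj m
    let ev : (P →ₗ[Rᵐᵒᵖ] R) →ₗ[R] R :=
      { toFun := fun φ => φ p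
        map_add' := fun _ _ => rfl
        map_smul' := fun _ _ => rfl }
    have hse : IsShortExact (A := LinearMap.ker (dualL (R := R) d₁)) (B := P →ₗ[Rᵐᵒᵖ] R)
        (C := LinearMap.range (dualL (R := R) d₁)) (LinearMap.ker (dualL (R := R) d₁)).subtype
        (dualL (R := R) d₁).rangeRestrict :=
      ⟨Subtype.val_injective, fun x => by simp [Subtype.ext_iff],
        (dualL d₁).surjective_rangeRestrict⟩
    obtain ⟨θ, hθ⟩ := hse.exists_desc ev (by
      rintro ⟨ψ, hψ⟩
      obtain ⟨φ, hφ⟩ := (isShortExact_ker hsurj).exists_desc ψ (by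
        rintro ⟨x, hx⟩
        obtain ⟨y, rfl⟩ := (hex x).1 hx
        exact LinearMap.congr_fun hψ y)
      change ψ p = 0
      rw [← hφ, hm])
    obtain ⟨Θ, hΘ⟩ := (isShortExact_transpose d₁).exists_extend h θ
    obtain ⟨q, hq⟩ := exists_eval_eq Θ
    have : p = d₁ q := by
      refine eq_of_forall_dual (R := R) fun φ => ?_
      have h1 : θ ((dualL d₁).rangeRestrict φ) = φ p := hθ φ
      rw [← hΘ, hq] at h1
      exact h1.symm
    rw [this]
    exact (hex _).2 ⟨q, rfl⟩
  · intro h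
    have := projective_dual (R := R) P₁
    refine (isShortExact_transpose d₁).extZero_one (extZero_of_projective 0) fun θ => ?_
    obtain ⟨p, hp⟩ := exists_eval_eq (θ ∘ₗ (dualL d₁).rangeRestrict)
    have hp0 : d₀ p = 0 := by
      refine h _ fun φ => ?_
      have h1 := hp (φ ∘ₗ d₀)
      have h2 : (dualL d₁).rangeRestrict (φ ∘ₗ d₀) = 0 := by
        ext x
        simp [(hex _).2 ⟨x, rfl⟩]
      rw [LinearMap.comp_apply, h2, map_zero] at h1
      exact h1.symm
    obtain ⟨q, rfl⟩ := (hex p).1 hp0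
    let ev : (P₁ →ₗ[Rᵐᵒᵖ] R) →ₗ[R] R :=
      { toFun := fun φ => φ q
        map_add' := fun _ _ => rfl
        map_smul' := fun _ _ => rfl }
    refine ⟨ev, ?_⟩
    rintro ⟨_, φ, rfl⟩
    exact (hp φ).symm

end Duality

/-! ### Gorenstein projectivity through coresolutions -/

section GorensteinProjective

variable {R : Type u} [Ring R]

variable (R) in
/-- `M` is finitely generated, `Ext^j(M, R)` vanishes for `j ≥ 1`, and these properties persist
along `n` steps of a coresolution of `M` by finitely generated projective modules. -/
def IsNGorenstein : ℕ → ∀ (M : Type u) [AddCommGroup M] [Module Rᵐᵒᵖ M], Prop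
  | 0, M, _, _ => Module.Finite Rᵐᵒᵖ M ∧ ∀ j, ExtZero Rᵐᵒᵖ M R (j + 1)
  | n + 1, M, _, _ => (Module.Finite Rᵐᵒᵖ M ∧ ∀ j, ExtZero Rᵐᵒᵖ M R (j + 1)) ∧
      ∃ (Q M' : ModuleCat.{u} Rᵐᵒᵖ) (f : M →ₗ[Rᵐᵒᵖ] Q) (g : Q →ₗ[Rᵐᵒᵖ] M'),
        isFGProj R Q ∧ IsShortExact f g ∧ IsNGorenstein n M'

lemma IsNGorenstein.zero {n : ℕ} {M : Type u} [AddCommGroup M] [Module Rᵐᵒᵖ M]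
    (h : IsNGorenstein R n M) : IsNGorenstein R 0 M := by
  cases n with
  | zero => exact h
  | succ n => exact h.1

lemma IsNGorenstein.finite {n : ℕ} {M : Type u} [AddCommGroup M] [Module Rᵐᵒᵖ M]
    (h : IsNGorenstein R n M) : Module.Finite Rᵐᵒᵖ M := h.zero.1

lemma IsNGorenstein.extZero {n : ℕ} {M : Type u} [AddCommGroup M] [Module Rᵐᵒᵖ M]
    (h : IsNGorenstein R n M) (j : ℕ) : ExtZero Rᵐᵒᵖ M R (j + 1) := h.zero.2 j

lemma IsNGorenstein.of_succ {n : ℕ} {M : Type u} [AddCommGroup M] [Module Rᵐᵒᵖ M]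
    (h : IsNGorenstein R (n + 1) M) : IsNGorenstein R n M := by
  induction n generalizing M with
  | zero => exact h.zero
  | succ n ih =>
    obtain ⟨h0, Q, M', f, g, hQ, hfg, hM'⟩ := h
    exact ⟨h0, Q, M', f, g, hQ, hfg, ih hM'⟩

variable {M P P₁ : Type u} [AddCommGroup M] [Module Rᵐᵒᵖ M]
  [AddCommGroup P] [Module Rᵐᵒᵖ P] [AddCommGroup P₁] [Module Rᵐᵒᵖ P₁]

/-- Generators of $M^*$, finitely many because $R$ is left noetherian, form a map $s:M\to R^k$ along
which every functional extends. It is injective as $M$ is torsionless, and its cokernel inherits the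
hypotheses: its transpose is a syzygy of that of `M`, so Ext degrees drop by one. -/
lemma isNGorenstein_of_transpose [IsNoetherianRing R] (n : ℕ)
    [Module.Finite Rᵐᵒᵖ M] (hM : ∀ j, ExtZero Rᵐᵒᵖ M R (j + 1))
    [Module.Finite Rᵐᵒᵖ P₁] [Module.Projective Rᵐᵒᵖ P₁]
    [Module.Finite Rᵐᵒᵖ P] [Module.Projective Rᵐᵒᵖ P]
    {d₁ : P₁ →ₗ[Rᵐᵒᵖ] P} {d₀ : P →ₗ[Rᵐᵒᵖ] M}
    (hex : Function.Exact d₁ d₀) (hsurj : Function.Surjective d₀)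
    (htr : ∀ j, ExtZero R (Transpose (R := R) d₁) R (j + 1)) : IsNGorenstein R n M := by
  induction n generalizing M P P₁ with
  | zero => exact ⟨inferInstance, hM⟩
  | succ n ih =>
    refine ⟨⟨inferInstance, hM⟩, ?_⟩
    have := finite_dual (R := R) M
    obtain ⟨k, c, hc⟩ := Module.Finite.exists_fin' R (M →ₗ[Rᵐᵒᵖ] R)
    let s : M →ₗ[Rᵐᵒᵖ] (Fin k → R) := LinearMap.pi fun i => c (Pi.single i 1)
    have hext : ∀ φ : M →ₗ[Rᵐᵒᵖ] R, ∃ ψ : (Fin k → R) →ₗ[Rᵐᵒᵖ] R, ∀ x, ψ (s x) = φ x := by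
      intro φ
      obtain ⟨a, rfl⟩ := hc φ
      refine ⟨∑ i, a i • LinearMap.proj i, fun x => ?_⟩
      conv_rhs => rw [← LinearMap.sum_single_apply (φ := fun _ : Fin k => R) a, map_sum]
      simp only [LinearMap.sum_apply]
      refine Finset.sum_congr rfl fun i _ => ?_
      have : (Pi.single i (a i) : Fin k → R) = a i • Pi.single i 1 := by
        rw [← Pi.single_smul, smul_eq_mul, mul_one]
      rw [this, map_smul]
      rfl
    have hs : Function.Injective s := by
      rw [injective_iff_map_eq_zero]
      intro m hm
      refine (extZero_transpose_one_iff hex hsurj).1 (htr 0) m fun φ => ?_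
      obtain ⟨ψ, hψ⟩ := hext φ
      rw [← hψ, hm, map_zero]
    have : Module.Finite Rᵐᵒᵖ R := (ringObj R).2.1
    have : Module.Projective Rᵐᵒᵖ (Fin k → R) := Module.Projective.of_equiv'
      (LinearEquiv.piCongrRight fun _ : Fin k =>
        (MulOpposite.opLinearEquiv Rᵐᵒᵖ (M := R)).symm)
    have hse := isShortExact_mkQ hs
    refine ⟨ModuleCat.of Rᵐᵒᵖ (Fin k → R), ModuleCat.of Rᵐᵒᵖ (_ ⧸ LinearMap.range s), s, _,
      ⟨(inferInstance : Module.Finite Rᵐᵒᵖ (Fin k → R)),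
        this⟩, hse, ?_⟩
    refine ih (d₁ := s ∘ₗ d₀) (d₀ := (LinearMap.range s).mkQ) ?_ ?_ hse.surj ?_
    · rintro (_ | j)
      · exact hse.extZero_one (extZero_of_projective 0) hext
      · exact hse.extZero_right (hM j) (extZero_of_projective _)
    · intro x
      rw [hse.exact x]
      constructor
      · rintro ⟨m, rfl⟩
        obtain ⟨p, rfl⟩ := hsurj m
        exact ⟨p, rfl⟩
      · rintro ⟨p, rfl⟩
        exact ⟨d₀ p, rfl⟩
    · intro j
      exact (extZero_transpose_comp_iff hex hsurj s hext j).2 (htr (j + 1))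

/-- Each coresolution step lowers the Ext degree of the transpose by one. In degree one it remains
that the module reached embeds in a projective, so is torsionless. -/
lemma IsNGorenstein.extZero_transpose {n : ℕ} (hM : IsNGorenstein R (n + 1) M)
    [Module.Finite Rᵐᵒᵖ P₁] [Module.Projective Rᵐᵒᵖ P₁]
    [Module.Finite Rᵐᵒᵖ P] [Module.Projective Rᵐᵒᵖ P]
    {d₁ : P₁ →ₗ[Rᵐᵒᵖ] P} {d₀ : P →ₗ[Rᵐᵒᵖ] M}
    (hex : Function.Exact d₁ d₀) (hsurj : Function.Surjective d₀) :
    ExtZero R (Transpose (R := R) d₁) R (n + 1) := by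
  induction n generalizing M P P₁ with
  | zero =>
    obtain ⟨-, Q, M', f, g, hQ, hfg, hM'⟩ := hM
    refine (extZero_transpose_one_iff hex hsurj).2 fun m hm => hfg.inj ?_
    have := hQ.1
    have := hQ.2
    exact eq_of_forall_dual (R := R) fun φ => by rw [map_zero, map_zero]; exact hm (φ ∘ₗ f)
  | succ n ih =>
    obtain ⟨-, Q, M', f, g, hQ, hfg, hM'⟩ := hM
    have := hQ.1
    have := hQ.2
    refine (extZero_transpose_comp_iff hex hsurj f (hfg.exists_extend (hM'.extZero 0)) n).1 ?_
    refine ih (d₁ := f ∘ₗ d₀) hM' ?_ hfg.surj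
    intro x
    rw [hfg.exact x]
    constructor
    · rintro ⟨m, rfl⟩
      obtain ⟨p, rfl⟩ := hsurj m
      exact ⟨p, rfl⟩
    · rintro ⟨p, rfl⟩
      exact ⟨d₀ p, rfl⟩

lemma exists_finProjPresentation [IsNoetherianRing Rᵐᵒᵖ] (M : ModuleCat.{u} Rᵐᵒᵖ)
    [Module.Finite Rᵐᵒᵖ M] : Nonempty (FinProjPresentation M) := by
  obtain ⟨n, π, hπ⟩ := Module.Finite.exists_fin' Rᵐᵒᵖ M
  obtain ⟨m, ρ, hρ⟩ := Module.Finite.exists_fin' Rᵐᵒᵖ (LinearMap.ker π)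
  exact ⟨{
    P₁ := ModuleCat.of Rᵐᵒᵖ (Fin m → Rᵐᵒᵖ)
    P₀ := ModuleCat.of Rᵐᵒᵖ (Fin n → Rᵐᵒᵖ)
    d₁ := ModuleCat.ofHom ((LinearMap.ker π).subtype ∘ₗ ρ)
    d₀ := ModuleCat.ofHom π
    fgProj₁ := ⟨(inferInstance : Module.Finite Rᵐᵒᵖ (Fin m → Rᵐᵒᵖ)),
      (inferInstance : Module.Projective Rᵐᵒᵖ (Fin m → Rᵐᵒᵖ))⟩
    fgProj₀ := ⟨(inferInstance : Module.Finite Rᵐᵒᵖ (Fin n → Rᵐᵒᵖ)),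
      (inferInstance : Module.Projective Rᵐᵒᵖ (Fin n → Rᵐᵒᵖ))⟩
    surjective := hπ
    exact := by
      intro x
      constructor
      · intro hx
        obtain ⟨y, hy⟩ := hρ ⟨x, hx⟩
        exact ⟨y, congrArg Subtype.val hy⟩
      · rintro ⟨y, rfl⟩
        exact (ρ y).2 }⟩

lemma extZero_tr_iff {M : ModuleCat.{u} Rᵐᵒᵖ} (π : FinProjPresentation M) (j : ℕ) :
    Subsingleton (Abelian.Ext π.tr (ModuleCat.of R R) j) ↔
      ExtZero R (Transpose (R := R) π.d₁.hom) R j := by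
  let e := (ModuleCat.cokernelIsoRangeQuotient (dualMap π.d₁)).toLinearEquiv
  exact ⟨fun h => ExtZero.of_equiv (B := π.tr) h e.symm,
    fun h => ExtZero.of_equiv (A := π.tr) h e⟩

/-- The coresolutions for different `n` need not be compatible, since
$\operatorname{Ext}^j(\operatorname{Tr}M,R)$ involves only the first $j$ steps. -/
lemma isGorensteinProjective_iff [IsNoetherianRing R] [IsNoetherianRing Rᵐᵒᵖ]
    (M : ModuleCat.{u} Rᵐᵒᵖ) : IsGorensteinProjective M ↔ ∀ n, IsNGorenstein R n M := by
  constructor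
  · rintro ⟨hfin, hext, π, hπ⟩ n
    have := π.fgProj₁.1
    have := π.fgProj₁.2
    have := π.fgProj₀.1
    have := π.fgProj₀.2
    exact isNGorenstein_of_transpose n (fun j => hext (j + 1) (by lia)) π.exact π.surjective
      fun j => (extZero_tr_iff π _).1 (hπ (j + 1) (by lia))
  · intro h
    have hfin := (h 0).finite
    obtain ⟨π⟩ := exists_finProjPresentation M
    have := π.fgProj₁.1
    have := π.fgProj₁.2
    have := π.fgProj₀.1
    have := π.fgProj₀.2
    refine ⟨hfin, ?_, π, ?_⟩
    · rintro (_ | j) hj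
      · lia
      · exact (h 0).extZero j
    · rintro (_ | j) hj
      · lia
      · exact (extZero_tr_iff π _).2 ((h (j + 1)).extZero_transpose π.exact π.surjective)

end GorensteinProjective

/-! ### Closure under extensions, retracts and syzygies -/

section Closure

variable {R : Type u} [Ring R]
variable {A B C M N P : Type u} [AddCommGroup A] [Module Rᵐᵒᵖ A] [AddCommGroup B] [Module Rᵐᵒᵖ B]
  [AddCommGroup C] [Module Rᵐᵒᵖ C] [AddCommGroup M] [Module Rᵐᵒᵖ M]
  [AddCommGroup N] [Module Rᵐᵒᵖ N] [AddCommGroup P] [Module Rᵐᵒᵖ P]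

/-- A dual basis of `P` reduces the extension to functionals, which are extended one at a time. -/
lemma IsShortExact.exists_extend_projective {f : A →ₗ[Rᵐᵒᵖ] B} {g : B →ₗ[Rᵐᵒᵖ] C}
    (h : IsShortExact f g) (hC : ExtZero Rᵐᵒᵖ C R 1)
    [Module.Finite Rᵐᵒᵖ P] [Module.Projective Rᵐᵒᵖ P] (φ : A →ₗ[Rᵐᵒᵖ] P) :
    ∃ ψ : B →ₗ[Rᵐᵒᵖ] P, ∀ x, ψ (f x) = φ x := by
  obtain ⟨n, p, l, hpl⟩ := exists_dual_basis (R := R) P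
  choose χ hχ using fun k => h.exists_extend hC (l k ∘ₗ φ)
  refine ⟨∑ k, (LinearMap.toSpanSingleton Rᵐᵒᵖ P (p k)) ∘ₗ
    (MulOpposite.opLinearEquiv Rᵐᵒᵖ (M := R)).toLinearMap ∘ₗ χ k, fun x => ?_⟩
  conv_rhs => rw [← hpl (φ x)]
  simp [LinearMap.sum_apply, hχ]

lemma IsShortExact.finite_middle {f : A →ₗ[Rᵐᵒᵖ] B} {g : B →ₗ[Rᵐᵒᵖ] C}
    (h : IsShortExact f g) [Module.Finite Rᵐᵒᵖ A] [Module.Finite Rᵐᵒᵖ C] :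
    Module.Finite Rᵐᵒᵖ B := by
  have : Module.Finite Rᵐᵒᵖ (LinearMap.range f) := inferInstance
  have hr : LinearMap.range f = LinearMap.ker g := (LinearMap.exact_iff.1 h.exact).symm
  have : Module.Finite Rᵐᵒᵖ (B ⧸ LinearMap.range f) :=
    Module.Finite.equiv ((Submodule.quotEquivOfEq _ _ hr).trans
      (g.quotKerEquivOfSurjective h.surj)).symm
  exact Module.Finite.of_submodule_quotient (LinearMap.range f)

lemma isNGorenstein_of_projective (n : ℕ) [Module.Finite Rᵐᵒᵖ P] [Module.Projective Rᵐᵒᵖ P] :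
    IsNGorenstein R n P := by
  have h0 : Module.Finite Rᵐᵒᵖ P ∧ ∀ j, ExtZero Rᵐᵒᵖ P R (j + 1) :=
    ⟨inferInstance, fun j => extZero_of_projective j⟩
  induction n generalizing P with
  | zero => exact h0
  | succ n ih =>
    refine ⟨h0, ModuleCat.of Rᵐᵒᵖ P, ModuleCat.of Rᵐᵒᵖ PUnit.{u + 1}, LinearMap.id, 0,
      ⟨h0.1, (inferInstance : Module.Projective Rᵐᵒᵖ P)⟩,
      ⟨Function.injective_id, fun x => by simp, fun x => ⟨0, rfl⟩⟩, ?_⟩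
    exact ih (P := PUnit.{u + 1}) ⟨inferInstance, fun j => extZero_of_projective j⟩

/-- A horseshoe on the coresolution side. As $\operatorname{Ext}^1(C,R)=0$, the embedding of `A` in
`QA` extends to `B`; together with `ιC ∘ g` it embeds `B` in `QA × QC`, and the cokernels again form
a short exact sequence. -/
lemma IsNGorenstein.middle {n : ℕ} {f : A →ₗ[Rᵐᵒᵖ] B} {g : B →ₗ[Rᵐᵒᵖ] C}
    (h : IsShortExact f g) (hA : IsNGorenstein R n A) (hC : IsNGorenstein R n C) :
    IsNGorenstein R n B := by
  have h0 : Module.Finite Rᵐᵒᵖ B ∧ ∀ j, ExtZero Rᵐᵒᵖ B R (j + 1) := by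
    have := hA.finite
    have := hC.finite
    exact ⟨h.finite_middle, fun j => h.extZero_middle (hA.extZero j) (hC.extZero j)⟩
  induction n generalizing A B C with
  | zero => exact h0
  | succ n ih =>
    have hC1 := hC.extZero 0
    obtain ⟨-, QA, A', ιA, πA, hQA, hsA, hA'⟩ := hA
    obtain ⟨-, QC, C', ιC, πC, hQC, hsC, hC'⟩ := hC
    have := hQA.1
    have := hQA.2
    have := hQC.1
    have := hQC.2
    obtain ⟨e, he⟩ := h.exists_extend_projective hC1 ιA
    let t : B →ₗ[Rᵐᵒᵖ] QA × QC := e.prod (ιC ∘ₗ g)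
    have ht : Function.Injective t := by
      rw [injective_iff_map_eq_zero]
      intro b hb
      have h1 : e b = 0 := congrArg Prod.fst hb
      have h2 : ιC (g b) = 0 := congrArg Prod.snd hb
      obtain ⟨a, rfl⟩ := (h.exact b).1 (hsC.inj (by rw [h2, map_zero]))
      rw [he] at h1
      rw [hsA.inj (h1.trans (map_zero _).symm), map_zero]
    have hst := isShortExact_mkQ ht
    obtain ⟨α, hα⟩ := hsA.exists_desc ((LinearMap.range t).mkQ ∘ₗ LinearMap.inl Rᵐᵒᵖ QA QC) (by
      intro a
      refine (hst.exact _).2 ⟨f a, ?_⟩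
      simp [t, he, h.apply_apply])
    obtain ⟨β, hβ⟩ := hst.exists_desc (πC ∘ₗ LinearMap.snd Rᵐᵒᵖ QA QC) (by
      intro b
      simp [t, hsC.apply_apply])
    have hαβ : IsShortExact α β := by
      refine ⟨?_, ?_, ?_⟩
      · rw [injective_iff_map_eq_zero]
        intro a' ha'
        obtain ⟨q, rfl⟩ := hsA.surj a'
        rw [hα] at ha'
        obtain ⟨b, hb⟩ := (hst.exact _).1 ha'
        have h1 : e b = q := congrArg Prod.fst hb
        have h2 : ιC (g b) = 0 := congrArg Prod.snd hb
        obtain ⟨a, rfl⟩ := (h.exact b).1 (hsC.inj (by rw [h2, map_zero]))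
        rw [← h1, he, hsA.apply_apply]
      · intro y
        obtain ⟨⟨q₁, q₂⟩, rfl⟩ := hst.surj y
        rw [hβ]
        constructor
        · intro hq
          obtain ⟨c, hc⟩ := (hsC.exact q₂).1 hq
          obtain ⟨b, rfl⟩ := h.surj c
          refine ⟨πA (q₁ - e b), ?_⟩
          rw [hα, ← sub_eq_zero, LinearMap.comp_apply, ← map_sub]
          refine (hst.exact _).2 ⟨-b, ?_⟩
          ext
          · simp [t]
          · simp [t, hc]
        · rintro ⟨a', ha'⟩
          obtain ⟨q, rfl⟩ := hsA.surj a'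
          rw [hα] at ha'
          rw [← hβ, ← ha', LinearMap.comp_apply, hβ]
          simp
      · intro c'
        obtain ⟨q, rfl⟩ := hsC.surj c'
        exact ⟨(LinearMap.range t).mkQ (0, q), by rw [hβ]; simp⟩
    refine ⟨h0, ModuleCat.of Rᵐᵒᵖ (QA × QC), ModuleCat.of Rᵐᵒᵖ (_ ⧸ LinearMap.range t), t, _,
      ⟨(inferInstance : Module.Finite Rᵐᵒᵖ (QA × QC)),
        (inferInstance : Module.Projective Rᵐᵒᵖ (QA × QC))⟩, hst, ih hαβ hA' hC' ?_⟩
    have := hA'.finite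
    have := hC'.finite
    exact ⟨hαβ.finite_middle, fun j => hαβ.extZero_middle (hA'.extZero j) (hC'.extZero j)⟩

/-- Let $D$ be the cokernel of $M\to N\to Q$. The sequence $0\to N\to D\oplus M\to N'\to0$ is exact,
so $D\oplus M$ has `n` steps as an extension. Its retract $D$ then does too by induction, and serves
as the cosyzygy of `M`. -/
lemma IsNGorenstein.of_retract {n : ℕ} (hN : IsNGorenstein R n N) (i : M →ₗ[Rᵐᵒᵖ] N)
    (r : N →ₗ[Rᵐᵒᵖ] M) (hri : ∀ x, r (i x) = x) : IsNGorenstein R n M := by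
  have h0 : Module.Finite Rᵐᵒᵖ M ∧ ∀ j, ExtZero Rᵐᵒᵖ M R (j + 1) := by
    have := hN.finite
    exact ⟨Module.Finite.of_surjective r fun x => ⟨i x, hri x⟩,
      fun j => (hN.extZero j).of_retract i r hri⟩
  induction n generalizing M N with
  | zero => exact h0
  | succ n ih =>
    have hNn := hN.of_succ
    obtain ⟨-, Q, N', f, g, hQ, hfg, hN'⟩ := hN
    have hi : Function.Injective i := Function.LeftInverse.injective hri
    have hinj : Function.Injective (f ∘ₗ i) := hfg.inj.comp hi
    have hst := isShortExact_mkQ hinj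
    obtain ⟨γ, hγ⟩ := hst.exists_desc g (fun x => hfg.apply_apply _)
    let D : Type u := Q ⧸ LinearMap.range (f ∘ₗ i)
    let α : N →ₗ[Rᵐᵒᵖ] D × M := ((LinearMap.range (f ∘ₗ i)).mkQ ∘ₗ f).prod r
    let β : D × M →ₗ[Rᵐᵒᵖ] N' := γ ∘ₗ LinearMap.fst Rᵐᵒᵖ D M
    have hαβ : IsShortExact α β := by
      refine ⟨?_, ?_, ?_⟩
      · rw [injective_iff_map_eq_zero]
        intro x hx
        have h1 : (LinearMap.range (f ∘ₗ i)).mkQ (f x) = 0 := congrArg Prod.fst hx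
        have h2 : r x = 0 := congrArg Prod.snd hx
        obtain ⟨m, hm⟩ := (hst.exact _).1 h1
        have hm' : i m = x := hfg.inj hm
        rw [← hm', hri] at h2
        rw [← hm', h2, map_zero]
      · rintro ⟨y, m⟩
        obtain ⟨q, rfl⟩ := hst.surj y
        constructor
        · intro hq
          have hq' : g q = 0 := by rw [← hγ]; exact hq
          obtain ⟨x, rfl⟩ := (hfg.exact q).1 hq'
          refine ⟨x + i (m - r x), ?_⟩
          ext
          · have : (LinearMap.range (f ∘ₗ i)).mkQ (f (i (m - r x))) = 0 :=
              (hst.exact _).2 ⟨m - r x, rfl⟩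
            change (LinearMap.range (f ∘ₗ i)).mkQ (f (x + i (m - r x))) = _
            rw [map_add, map_add, this, add_zero]
          · simp [α, hri]
        · rintro ⟨x, hx⟩
          have h1 : (LinearMap.range (f ∘ₗ i)).mkQ (f x) = (LinearMap.range (f ∘ₗ i)).mkQ q :=
            congrArg Prod.fst hx
          change γ ((LinearMap.range (f ∘ₗ i)).mkQ q) = 0
          rw [← h1, hγ, hfg.apply_apply]
      · intro y
        obtain ⟨q, rfl⟩ := hfg.surj y
        exact ⟨((LinearMap.range (f ∘ₗ i)).mkQ q, 0), hγ q⟩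
    have hDM : IsNGorenstein R n (D × M) := hNn.middle hαβ hN'
    refine ⟨h0, Q, ModuleCat.of Rᵐᵒᵖ D, f ∘ₗ i, _, hQ, hst,
      ih hDM (LinearMap.inl _ _ _) (LinearMap.fst _ _ _) (fun _ => rfl) ⟨?_, fun j => ?_⟩⟩
    · have := hDM.finite
      exact Module.Finite.of_surjective (LinearMap.fst Rᵐᵒᵖ D M) Prod.fst_surjective
    · exact (hDM.extZero j).of_retract (LinearMap.inl _ _ _) (LinearMap.fst _ _ _) (fun _ => rfl)

lemma IsNGorenstein.syzygy [IsNoetherianRing Rᵐᵒᵖ] {n : ℕ} (hC : IsNGorenstein R n C)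
    [Module.Finite Rᵐᵒᵖ B] [Module.Projective Rᵐᵒᵖ B] {f : A →ₗ[Rᵐᵒᵖ] B} {g : B →ₗ[Rᵐᵒᵖ] C}
    (h : IsShortExact f g) : IsNGorenstein R (n + 1) A :=
  ⟨⟨Module.Finite.of_injective f h.inj,
      fun j => h.extZero_left (extZero_of_projective j) (hC.extZero (j + 1))⟩,
    ModuleCat.of Rᵐᵒᵖ B, ModuleCat.of Rᵐᵒᵖ C, f, g, ⟨inferInstance, inferInstance⟩, h, hC⟩

end Closure

/-! ### Gorenstein dimension of modules through syzygies -/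

section GorensteinDimension

variable {R : Type u} [Ring R]

variable (R) in
/-- `M` has Gorenstein dimension at most `n`: an `n`th syzygy of `M` is Gorenstein projective. -/
def GdimLE : ℕ → ∀ (M : Type u) [AddCommGroup M] [Module Rᵐᵒᵖ M], Prop
  | 0, M, _, _ => ∀ n, IsNGorenstein R n M
  | n + 1, M, _, _ => ∃ (K P : ModuleCat.{u} Rᵐᵒᵖ) (f : K →ₗ[Rᵐᵒᵖ] P) (g : P →ₗ[Rᵐᵒᵖ] M),
      isFGProj R P ∧ IsShortExact f g ∧ GdimLE n K

variable {A B C K L M N P Q : Type u} [AddCommGroup A] [Module Rᵐᵒᵖ A] [AddCommGroup B]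
  [Module Rᵐᵒᵖ B] [AddCommGroup C] [Module Rᵐᵒᵖ C] [AddCommGroup M] [Module Rᵐᵒᵖ M]
  [AddCommGroup N] [Module Rᵐᵒᵖ N] [AddCommGroup P] [Module Rᵐᵒᵖ P]
  [AddCommGroup K] [Module Rᵐᵒᵖ K] [AddCommGroup L] [Module Rᵐᵒᵖ L]
  [AddCommGroup Q] [Module Rᵐᵒᵖ Q]

lemma GdimLE.finite {n : ℕ} (hM : GdimLE R n M) : Module.Finite Rᵐᵒᵖ M := by
  cases n with
  | zero => exact (hM 0).finite
  | succ n =>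
    obtain ⟨K, P, f, g, hP, hfg, -⟩ := hM
    have := hP.1
    exact Module.Finite.of_surjective g hfg.surj

lemma exists_syzygy (M : Type u) [AddCommGroup M] [Module Rᵐᵒᵖ M] [Module.Finite Rᵐᵒᵖ M] :
    ∃ (K P : ModuleCat.{u} Rᵐᵒᵖ) (f : K →ₗ[Rᵐᵒᵖ] P) (g : P →ₗ[Rᵐᵒᵖ] M),
      isFGProj R P ∧ IsShortExact f g := by
  obtain ⟨n, π, hπ⟩ := Module.Finite.exists_fin' Rᵐᵒᵖ M
  exact ⟨ModuleCat.of _ (LinearMap.ker π), ModuleCat.of _ (Fin n → Rᵐᵒᵖ), _, π,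
    ⟨(inferInstance : Module.Finite Rᵐᵒᵖ (Fin n → Rᵐᵒᵖ)),
      (inferInstance : Module.Projective Rᵐᵒᵖ (Fin n → Rᵐᵒᵖ))⟩, isShortExact_ker hπ⟩

/-- A variant of Schanuel's lemma: a syzygy of a retract of `N` is a retract of a syzygy of `N`,
up to projective summands. -/
lemma exists_retract_syzygy [Module.Projective Rᵐᵒᵖ P] [Module.Projective Rᵐᵒᵖ Q]
    {f : L →ₗ[Rᵐᵒᵖ] P} {g : P →ₗ[Rᵐᵒᵖ] M} (h : IsShortExact f g)
    {f' : K →ₗ[Rᵐᵒᵖ] Q} {g' : Q →ₗ[Rᵐᵒᵖ] N} (h' : IsShortExact f' g')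
    (i : M →ₗ[Rᵐᵒᵖ] N) (r : N →ₗ[Rᵐᵒᵖ] M) (hri : ∀ x, r (i x) = x) :
    ∃ (j : L →ₗ[Rᵐᵒᵖ] K × P) (s : K × P →ₗ[Rᵐᵒᵖ] L), ∀ x, s (j x) = x := by
  obtain ⟨I, hI⟩ := Module.projective_lifting_property g' (i ∘ₗ g) h'.surj
  obtain ⟨ρ, hρ⟩ := Module.projective_lifting_property g (r ∘ₗ g') h.surj
  have hI' : ∀ x, g' (I x) = i (g x) := fun x => LinearMap.congr_fun hI x
  have hρ' : ∀ x, g (ρ x) = r (g' x) := fun x => LinearMap.congr_fun hρ x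
  -- Because `r ∘ i = id`, the map `id - ρ ∘ I` has image in `L`. Using the extra summand `P`, it
  -- corrects `ρ₀ ∘ I₀` to the identity.
  obtain ⟨η, hη⟩ := h.exists_lift (LinearMap.id - ρ ∘ₗ I) (by
    intro x
    simp [hρ', hI', hri])
  obtain ⟨I₀, hI₀⟩ := h'.exists_lift (I ∘ₗ f) (by
    intro x
    simp [hI', h.apply_apply])
  obtain ⟨ρ₀, hρ₀⟩ := h.exists_lift (ρ ∘ₗ f') (by
    intro x
    simp [hρ', h'.apply_apply])
  refine ⟨I₀.prod f, ρ₀.coprod η, fun x => h.inj ?_⟩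
  simp [hη, hρ₀, hI₀]

lemma GdimLE.prod_projective {n : ℕ} (hM : GdimLE R n M) [Module.Finite Rᵐᵒᵖ P]
    [Module.Projective Rᵐᵒᵖ P] : GdimLE R n (M × P) := by
  cases n with
  | zero =>
    exact fun n => (isNGorenstein_of_projective n (P := P)).middle
      (f := LinearMap.inr Rᵐᵒᵖ M P) (g := LinearMap.fst Rᵐᵒᵖ M P)
      ⟨LinearMap.inr_injective, fun x => by
        constructor
        · intro hx; exact ⟨x.2, by ext <;> simp_all⟩
        · rintro ⟨y, rfl⟩; simp, Prod.fst_surjective⟩ (hM n)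
  | succ n =>
    obtain ⟨K, Q, f, g, hQ, hfg, hK⟩ := hM
    have := hQ.1
    have := hQ.2
    refine ⟨K, ModuleCat.of Rᵐᵒᵖ (Q × P), LinearMap.inl Rᵐᵒᵖ Q P ∘ₗ f,
      g.prodMap LinearMap.id,
      ⟨(inferInstance : Module.Finite Rᵐᵒᵖ (Q × P)),
        (inferInstance : Module.Projective Rᵐᵒᵖ (Q × P))⟩, ⟨?_, ?_, ?_⟩, hK⟩
    · exact LinearMap.inl_injective.comp hfg.inj
    · rintro ⟨q, p⟩
      constructor
      · intro h
        obtain ⟨k, rfl⟩ := (hfg.exact q).1 (congrArg Prod.fst h)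
        have : p = 0 := congrArg Prod.snd h
        exact ⟨k, by simp [this]⟩
      · rintro ⟨k, hk⟩
        rw [← hk]
        simp [hfg.apply_apply]
    · rintro ⟨m, p⟩
      obtain ⟨q, rfl⟩ := hfg.surj m
      exact ⟨(q, p), rfl⟩

/-- The horseshoe lemma. -/
lemma IsShortExact.exists_horseshoe {f : A →ₗ[Rᵐᵒᵖ] B} {g : B →ₗ[Rᵐᵒᵖ] C}
    (h : IsShortExact f g) [Module.Projective Rᵐᵒᵖ Q]
    {fA : K →ₗ[Rᵐᵒᵖ] P} {gA : P →ₗ[Rᵐᵒᵖ] A} (hA : IsShortExact fA gA)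
    {fC : L →ₗ[Rᵐᵒᵖ] Q} {gC : Q →ₗ[Rᵐᵒᵖ] C} (hC : IsShortExact fC gC) :
    ∃ (W : ModuleCat.{u} Rᵐᵒᵖ) (fB : W →ₗ[Rᵐᵒᵖ] P × Q) (gB : P × Q →ₗ[Rᵐᵒᵖ] B)
      (α : K →ₗ[Rᵐᵒᵖ] W) (β : W →ₗ[Rᵐᵒᵖ] L), IsShortExact fB gB ∧ IsShortExact α β := by
  obtain ⟨t, ht⟩ := Module.projective_lifting_property g gC h.surj
  have ht' : ∀ x, g (t x) = gC x := fun x => LinearMap.congr_fun ht x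
  let gB : P × Q →ₗ[Rᵐᵒᵖ] B := (f ∘ₗ gA).coprod t
  have hgB : ∀ x, gB x = f (gA x.1) + t x.2 := fun x => rfl
  have hsurj : Function.Surjective gB := by
    intro b
    obtain ⟨q, hq⟩ := hC.surj (g b)
    obtain ⟨a, ha⟩ := (h.exact (b - t q)).1 (by rw [map_sub, ht', hq, sub_self])
    obtain ⟨p, rfl⟩ := hA.surj a
    exact ⟨(p, q), by rw [hgB, ha]; simp⟩
  have hB := isShortExact_ker hsurj
  obtain ⟨α, hα⟩ := hB.exists_lift (LinearMap.inl Rᵐᵒᵖ P Q ∘ₗ fA) (by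
    intro x
    simp [hgB, hA.apply_apply])
  obtain ⟨β, hβ⟩ := hC.exists_lift (LinearMap.snd Rᵐᵒᵖ P Q ∘ₗ (LinearMap.ker gB).subtype) (by
    rintro ⟨x, hx⟩
    have := congrArg g (hx : gB x = 0)
    rw [hgB, map_add, h.apply_apply, zero_add, ht', map_zero] at this
    exact this)
  refine ⟨ModuleCat.of Rᵐᵒᵖ (LinearMap.ker gB), _, gB, α, β, hB, ?_, ?_, ?_⟩
  · intro x y hxy
    refine hA.inj ?_
    have := congrArg (fun z => ((LinearMap.ker gB).subtype z).1) hxy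
    simpa [hα] using this
  · rintro ⟨⟨p, q⟩, hx⟩
    have hβ' := hβ ⟨⟨p, q⟩, hx⟩
    constructor
    · intro h0
      rw [h0, map_zero] at hβ'
      have hq : q = 0 := hβ'.symm
      subst hq
      have hp : gA p = 0 := h.inj (by
        have : gB (p, 0) = 0 := hx
        rw [hgB] at this
        simpa using this)
      obtain ⟨k, rfl⟩ := (hA.exact p).1 hp
      exact ⟨k, Subtype.ext (hα k)⟩
    · rintro ⟨k, hk⟩
      rw [← hk]
      refine hC.inj ?_
      rw [hβ]
      have : ((LinearMap.ker gB).subtype (α k)).2 = 0 := by rw [hα]; rfl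
      rw [map_zero]
      exact this
  · intro l
    have h1 : g (t (fC l)) = 0 := by rw [ht', hC.apply_apply]
    obtain ⟨a, ha⟩ := (h.exact _).1 h1
    obtain ⟨p, rfl⟩ := hA.surj a
    refine ⟨⟨(-p, fC l), ?_⟩, hC.inj ?_⟩
    · rw [LinearMap.mem_ker, hgB]
      simp [ha]
    · rw [hβ]
      rfl

lemma GdimLE.of_retract {n : ℕ} (hN : GdimLE R n N) (i : M →ₗ[Rᵐᵒᵖ] N)
    (r : N →ₗ[Rᵐᵒᵖ] M) (hri : ∀ x, r (i x) = x) : GdimLE R n M := by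
  induction n generalizing M N with
  | zero => exact fun n => (hN n).of_retract i r hri
  | succ n ih =>
    have := hN.finite
    have : Module.Finite Rᵐᵒᵖ M := Module.Finite.of_surjective r fun x => ⟨i x, hri x⟩
    obtain ⟨K, Q, f', g', hQ, h', hK⟩ := hN
    obtain ⟨L, P, f, g, hP, h⟩ := exists_syzygy (R := R) M
    have := hP.1
    have := hP.2
    have := hQ.2
    obtain ⟨j, s, hjs⟩ := exists_retract_syzygy h h' i r hri
    exact ⟨L, P, f, g, hP, h, ih (hK.prod_projective (P := P)) j s hjs⟩

lemma GdimLE.of_equiv {n : ℕ} (hN : GdimLE R n N) (e : M ≃ₗ[Rᵐᵒᵖ] N) : GdimLE R n M :=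
  hN.of_retract e.toLinearMap e.symm.toLinearMap (by simp)

/-- Any syzygy of a module of Gorenstein dimension at most `n + 1` has Gorenstein dimension at
most `n`. -/
lemma GdimLE.syzygy {n : ℕ} (hM : GdimLE R (n + 1) M) [Module.Projective Rᵐᵒᵖ P]
    [Module.Finite Rᵐᵒᵖ P]
    {f : L →ₗ[Rᵐᵒᵖ] P} {g : P →ₗ[Rᵐᵒᵖ] M} (h : IsShortExact f g) : GdimLE R n L := by
  obtain ⟨K, Q, f', g', hQ, h', hK⟩ := hM
  have := hQ.2
  obtain ⟨j, s, hjs⟩ := exists_retract_syzygy h h' LinearMap.id LinearMap.id fun _ => rfl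
  exact (hK.prod_projective (P := P)).of_retract j s hjs

lemma GdimLE.middle {n : ℕ} {f : A →ₗ[Rᵐᵒᵖ] B} {g : B →ₗ[Rᵐᵒᵖ] C}
    (h : IsShortExact f g) (hA : GdimLE R n A) (hC : GdimLE R n C) : GdimLE R n B := by
  induction n generalizing A B C with
  | zero => exact fun n => (hA n).middle h (hC n)
  | succ n ih =>
    obtain ⟨K, P, fA, gA, hP, hA, hK⟩ := hA
    obtain ⟨L, Q, fC, gC, hQ, hC, hL⟩ := hC
    have := hP.1
    have := hP.2
    have := hQ.1
    have := hQ.2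
    obtain ⟨W, fB, gB, α, β, hB, hW⟩ := h.exists_horseshoe hA hC
    exact ⟨W, ModuleCat.of Rᵐᵒᵖ (P × Q), fB, gB,
      ⟨(inferInstance : Module.Finite Rᵐᵒᵖ (P × Q)),
        (inferInstance : Module.Projective Rᵐᵒᵖ (P × Q))⟩, hB, ih hW hK hL⟩

variable [IsNoetherianRing Rᵐᵒᵖ]

lemma GdimLE.succ {n : ℕ} (hM : GdimLE R n M) : GdimLE R (n + 1) M := by
  induction n generalizing M with
  | zero =>
    have := hM.finite
    obtain ⟨K, P, f, g, hP, h⟩ := exists_syzygy (R := R) M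
    have := hP.1
    have := hP.2
    exact ⟨K, P, f, g, hP, h, fun n => ((hM n).syzygy h).of_succ⟩
  | succ n ih =>
    obtain ⟨K, P, f, g, hP, h, hK⟩ := hM
    exact ⟨K, P, f, g, hP, h, ih hK⟩

lemma GdimLE.mono {m n : ℕ} (hM : GdimLE R m M) (hmn : m ≤ n) : GdimLE R n M := by
  induction hmn with
  | refl => exact hM
  | step _ ih => exact ih.succ

/-- For a projective cover map $P\to C$ (any surjection) with kernel $K$, the pullback of $B\to
C\leftarrow P$ splits as $A\oplus P$ over $P$, and it is an extension of $B$ by $K$. -/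
lemma GdimLE.left {n : ℕ} {f : A →ₗ[Rᵐᵒᵖ] B} {g : B →ₗ[Rᵐᵒᵖ] C}
    (h : IsShortExact f g) (hB : GdimLE R 0 B) (hC : GdimLE R (n + 1) C) : GdimLE R n A := by
  obtain ⟨K, P, f', g', hP, h', hK⟩ := hC
  have := hP.1
  have := hP.2
  obtain ⟨t, ht⟩ := Module.projective_lifting_property g g' h.surj
  have ht' : ∀ x, g (t x) = g' x := fun x => LinearMap.congr_fun ht x
  -- `A × P` is an extension of `B` by `K`
  obtain ⟨k, hk⟩ := h.exists_lift (t ∘ₗ f') (by intro x; simp [ht', h'.apply_apply])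
  have hse : IsShortExact ((-k).prod f') (f.coprod t) := by
    refine ⟨?_, ?_, ?_⟩
    · intro x y hxy
      exact h'.inj (congrArg Prod.snd hxy)
    · rintro ⟨a, p⟩
      constructor
      · intro hap
        have hap' : f a + t p = 0 := hap
        obtain ⟨x, rfl⟩ := (h'.exact p).1 (by
          have := congrArg g hap'
          rwa [map_add, h.apply_apply, zero_add, ht', map_zero] at this)
        refine ⟨x, ?_⟩
        ext
        · refine h.inj ?_
          have : f (k x) = t (f' x) := hk x
          simp [this, eq_neg_of_add_eq_zero_left hap']
        · rfl
      · rintro ⟨x, hx⟩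
        rw [← hx]
        simp [hk]
    · intro b
      obtain ⟨p, hp⟩ := h'.surj (g b)
      obtain ⟨a, ha⟩ := (h.exact (b - t p)).1 (by rw [map_sub, ht', hp, sub_self])
      exact ⟨(a, p), by simp [ha]⟩
  exact (hK.middle hse (hB.mono (Nat.zero_le n))).of_retract (LinearMap.inl _ _ _)
    (LinearMap.fst _ _ _) fun _ => rfl

/-- For a surjection $P\to B$ from a projective, the kernel of $P\to C$ is an extension of `A` by a
syzygy of `B`. -/
lemma GdimLE.right {n : ℕ} {f : A →ₗ[Rᵐᵒᵖ] B} {g : B →ₗ[Rᵐᵒᵖ] C}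
    (h : IsShortExact f g) (hB : GdimLE R 0 B) (hA : GdimLE R n A) : GdimLE R (n + 1) C := by
  have := hB.finite
  obtain ⟨K, P, f', g', hP, h'⟩ := exists_syzygy (R := R) B
  have := hP.1
  have := hP.2
  have hK : GdimLE R 0 K := hB.succ.syzygy h'
  have hsurj : Function.Surjective (g ∘ₗ g') := h.surj.comp h'.surj
  have hs := isShortExact_ker hsurj
  obtain ⟨α, hα⟩ := hs.exists_lift f' (by intro x; simp [h'.apply_apply])
  obtain ⟨β, hβ⟩ := h.exists_lift (g' ∘ₗ (LinearMap.ker (g ∘ₗ g')).subtype) fun x => x.2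
  refine ⟨ModuleCat.of Rᵐᵒᵖ (LinearMap.ker (g ∘ₗ g')), P, _, _, hP, hs,
    (hK.mono (Nat.zero_le n)).middle (f := α) (g := β) ⟨?_, ?_, ?_⟩ hA⟩
  · intro x y hxy
    refine h'.inj ?_
    rw [← hα, ← hα, hxy]
  · intro x
    constructor
    · intro hx
      have h1 := hβ x
      rw [hx, map_zero] at h1
      obtain ⟨y, hy⟩ := (h'.exact x.1).1 h1.symm
      exact ⟨y, Subtype.ext ((hα y).trans hy)⟩
    · rintro ⟨y, rfl⟩
      refine h.inj ?_
      rw [hβ, LinearMap.comp_apply, hα, h'.apply_apply, map_zero]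
  · intro a
    obtain ⟨p, hp⟩ := h'.surj (f a)
    exact ⟨⟨p, by simp [hp, h.apply_apply]⟩, h.inj (by rw [hβ]; exact hp)⟩

end GorensteinDimension

/-! ### Comparison with resolutions by Gorenstein projectives -/

section ModuleResolution

variable {R : Type u} [Ring R]

lemma HasModuleGorensteinResolution.of_syzygy {n : ℕ} {K P M : ModuleCat.{u} Rᵐᵒᵖ}
    {f : K →ₗ[Rᵐᵒᵖ] P} {g : P →ₗ[Rᵐᵒᵖ] M} (hfg : IsShortExact f g)
    (hP : IsGorensteinProjective P) (hK : HasModuleGorensteinResolution n K) :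
    HasModuleGorensteinResolution (n + 1) M := by
  obtain ⟨X, d, ε, hX, hX', hε, hd, hdd⟩ := hK
  refine ⟨fun i => Nat.casesOn i P X,
    fun i => Nat.casesOn i (ε ≫ ModuleCat.ofHom f) d, ModuleCat.ofHom g, ?_, ?_, hfg.surj, ?_, ?_⟩
  · rintro (_ | i) hi
    · exact hP
    · exact hX i (by lia)
  · rintro (_ | i) hi
    · lia
    · exact hX' i (by lia)
  · intro x
    refine (hfg.exact x).trans ⟨?_, ?_⟩
    · rintro ⟨k, rfl⟩
      obtain ⟨y, rfl⟩ := hε k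
      exact ⟨y, rfl⟩
    · rintro ⟨y, rfl⟩
      exact ⟨ε y, rfl⟩
  · rintro (_ | i)
    · intro x
      refine Iff.trans ?_ (hd x)
      constructor
      · intro hx
        exact hfg.inj (hx.trans (map_zero f).symm)
      · intro hx
        change f (ε x) = 0
        rw [hx, map_zero]
    · exact hdd i

lemma hasModuleGorensteinResolution_zero {M : ModuleCat.{u} Rᵐᵒᵖ}
    (hM : IsGorensteinProjective M) : HasModuleGorensteinResolution 0 M := by
  refine ⟨fun i => Nat.casesOn i M fun _ => ModuleCat.of Rᵐᵒᵖ PUnit.{u + 1}, fun _ => 0, 𝟙 M,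
    ?_, ?_, fun x => ⟨x, rfl⟩, ?_, ?_⟩
  · rintro i hi
    obtain rfl : i = 0 := by lia
    exact hM
  · rintro (_ | i) hi
    · lia
    · exact (inferInstance : Subsingleton PUnit)
  · intro x
    constructor
    · intro hx
      exact ⟨0, (map_zero _).trans hx.symm⟩
    · rintro ⟨y, rfl⟩
      rfl
  · intro i x
    exact ⟨fun _ => ⟨0, (inferInstance : Subsingleton PUnit).elim _ _⟩, fun _ => rfl⟩

variable [IsNoetherianRing R] [IsNoetherianRing Rᵐᵒᵖ]

lemma gdimLE_zero_iff (M : ModuleCat.{u} Rᵐᵒᵖ) : GdimLE R 0 M ↔ IsGorensteinProjective M :=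
  (isGorensteinProjective_iff M).symm

/-- The terms are only Gorenstein projective, so the kernel of the augmentation is not a syzygy in
the sense of `GdimLE`; `GdimLE.right` bridges this. -/
lemma HasModuleGorensteinResolution.gdimLE {n : ℕ} {M : ModuleCat.{u} Rᵐᵒᵖ}
    (h : HasModuleGorensteinResolution n M) : GdimLE R n M := by
  induction n generalizing M with
  | zero =>
    obtain ⟨X, d, ε, hX, hX', hε, hd, -⟩ := h
    have hinj : Function.Injective ε.hom := by
      rw [injective_iff_map_eq_zero]
      intro x hx
      obtain ⟨y, rfl⟩ := (hd x).1 hx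
      have := hX' (0 + 1) (by lia)
      rw [Subsingleton.elim y 0, map_zero]
    exact ((gdimLE_zero_iff _).2 (hX 0 le_rfl)).of_equiv
      (LinearEquiv.ofBijective ε.hom ⟨hinj, hε⟩).symm
  | succ n ih =>
    obtain ⟨X, d, ε, hX, hX', hε, hd, hdd⟩ := h
    have hs := isShortExact_ker (g := ε.hom) hε
    refine GdimLE.right hs ((gdimLE_zero_iff _).2 (hX 0 (by lia))) ?_
    obtain ⟨δ, hδ⟩ := hs.exists_lift (d 0).hom fun x => (hd _).2 ⟨x, rfl⟩
    refine ih (M := ModuleCat.of Rᵐᵒᵖ (LinearMap.ker ε.hom))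
      ⟨fun i => X (i + 1), fun i => d (i + 1), ModuleCat.ofHom δ, fun i hi => hX _ (by lia),
        fun i hi => hX' _ (by lia), ?_, ?_, fun i => hdd (i + 1)⟩
    · intro x
      obtain ⟨y, hy⟩ := (hd x.1).1 x.2
      exact ⟨y, hs.inj ((hδ y).trans hy)⟩
    · intro x
      rw [← hdd 0 x]
      constructor
      · intro hx
        exact (hδ x).symm.trans ((congrArg Subtype.val hx).trans rfl)
      · intro hx
        exact hs.inj ((hδ x).trans (hx.trans (map_zero _).symm))

lemma GdimLE.hasModuleGorensteinResolution {n : ℕ} {M : ModuleCat.{u} Rᵐᵒᵖ}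
    (h : GdimLE R n M) : HasModuleGorensteinResolution n M := by
  induction n generalizing M with
  | zero => exact hasModuleGorensteinResolution_zero ((gdimLE_zero_iff M).1 h)
  | succ n ih =>
    obtain ⟨K, P, f, g, hP, hfg, hK⟩ := h
    have := hP.1
    have := hP.2
    exact .of_syzygy hfg ((isGorensteinProjective_iff P).2
      fun n => isNGorenstein_of_projective n) (ih hK)

/-- A finite bound excludes the empty set, whose infimum is `⊤`. The infimum is then attained, and
`GdimLE.mono` passes from it to `n`. -/
lemma moduleGdim_le_iff (M : ModuleCat.{u} Rᵐᵒᵖ) (n : ℕ) :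
    moduleGdim M ≤ n ↔ GdimLE R n M := by
  constructor
  · intro h
    have hne : {m : ℕ∞ | ∃ n : ℕ, m = n ∧ HasModuleGorensteinResolution n M}.Nonempty := by
      by_contra hempty
      rw [Set.not_nonempty_iff_eq_empty] at hempty
      rw [moduleGdim, hempty, sInf_empty] at h
      exact absurd (top_le_iff.1 h) (ENat.natCast_ne_top n)
    obtain ⟨m, hm, hres⟩ := csInf_mem hne
    refine hres.gdimLE.mono ?_
    rw [moduleGdim, hm] at h
    exact_mod_cast h
  · intro h
    exact sInf_le ⟨n, rfl, h.hasModuleGorensteinResolution⟩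

end ModuleResolution

/-! ### Transport along linear equivalences -/

section Conjugation

variable {S : Type u} [Ring S] {A B C A' B' C' : Type u} [AddCommGroup A] [AddCommGroup B]
  [AddCommGroup C] [Module S A] [Module S B] [Module S C] [AddCommGroup A'] [AddCommGroup B']
  [AddCommGroup C'] [Module S A'] [Module S B'] [Module S C']

lemma IsShortExact.conj {f : A →ₗ[S] B} {g : B →ₗ[S] C} (h : IsShortExact f g)
    (eA : A' ≃ₗ[S] A) (eB : B' ≃ₗ[S] B) (eC : C' ≃ₗ[S] C) :
    IsShortExact (eB.symm.toLinearMap ∘ₗ f ∘ₗ eA.toLinearMap)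
      (eC.symm.toLinearMap ∘ₗ g ∘ₗ eB.toLinearMap) := by
  refine ⟨eB.symm.injective.comp (h.inj.comp eA.injective), ?_,
    eC.symm.surjective.comp (h.surj.comp eB.surjective)⟩
  intro x
  simp only [LinearMap.comp_apply, LinearEquiv.coe_coe, LinearEquiv.map_eq_zero_iff, h.exact _]
  constructor
  · rintro ⟨y, hy⟩
    exact ⟨eA.symm y, by simp [hy]⟩
  · rintro ⟨y, rfl⟩
    exact ⟨eA y, by simp⟩

lemma exists_retract_congr (eA : A' ≃ₗ[S] A) (eB : B' ≃ₗ[S] B) {s : A →ₗ[S] B} {r : B →ₗ[S] A}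
    (h : ∀ x, r (s x) = x) :
    ∃ (s' : A' →ₗ[S] B') (r' : B' →ₗ[S] A'), ∀ x, r' (s' x) = x :=
  ⟨eB.symm.toLinearMap ∘ₗ s ∘ₗ eA.toLinearMap, eA.symm.toLinearMap ∘ₗ r ∘ₗ eB.toLinearMap,
    fun x => by simp [h]⟩

end Conjugation

/-! ### The modules $C^i$ and cohomological surjectivity -/

section Complexes

variable {R : Type u} [Ring R]

/-- Complexes of finitely generated projective right modules. -/
abbrev CxProj (R : Type u) [Ring R] := CochainComplex (ProjCat R) ℤ

/-- The class of a complex in the homotopy category. -/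
abbrev toK (K : CxProj R) : KProj R := (HomotopyCategory.quotient _ _).obj K

/-- The linear map underlying a morphism of `proj R`. -/
def lin {A B : ProjCat R} (φ : A ⟶ B) : A.obj →ₗ[Rᵐᵒᵖ] B.obj := φ.hom.hom

/-- The morphism of `proj R` given by a linear map. -/
def homOfLin {A B : ProjCat R} (l : A.obj →ₗ[Rᵐᵒᵖ] B.obj) : A ⟶ B :=
  ObjectProperty.homMk (ModuleCat.ofHom l)

@[simp] lemma lin_homOfLin {A B : ProjCat R} (l : A.obj →ₗ[Rᵐᵒᵖ] B.obj) :
    lin (homOfLin l) = l := rfl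

lemma lin_injective {A B : ProjCat R} {φ ψ : A ⟶ B} (h : ∀ x, lin φ x = lin ψ x) : φ = ψ := by
  ext x
  exact h x

@[simp] lemma lin_comp {A B C : ProjCat R} (φ : A ⟶ B) (ψ : B ⟶ C) (x : A.obj) :
    lin (φ ≫ ψ) x = lin ψ (lin φ x) := rfl

@[simp] lemma lin_id {A : ProjCat R} (x : A.obj) : lin (𝟙 A) x = x := rfl

@[simp] lemma lin_zero {A B : ProjCat R} (x : A.obj) : lin (0 : A ⟶ B) x = 0 := rfl

@[simp] lemma lin_add {A B : ProjCat R} (φ ψ : A ⟶ B) (x : A.obj) :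
    lin (φ + ψ) x = lin φ x + lin ψ x := rfl

instance (A : ProjCat R) : Module.Finite Rᵐᵒᵖ A.obj := A.property.1

instance (A : ProjCat R) : Module.Projective Rᵐᵒᵖ A.obj := A.property.2

@[simp] lemma lin_d_d (K : CxProj R) (i j k : ℤ) (x : (K.X i).obj) :
    lin (K.d j k) (lin (K.d i j) x) = 0 := by
  rw [← lin_comp, K.d_comp_d, lin_zero]

lemma lin_f_d {K L : CxProj R} (f : K ⟶ L) (i j : ℤ) (x : (K.X i).obj) :
    lin (f.f j) (lin (K.d i j) x) = lin (L.d i j) (lin (f.f i) x) := by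
  rw [← lin_comp, ← lin_comp, f.comm]

/-- The quotient `X^i / Im d^{i-1}`. -/
abbrev CokerMod (K : CxProj R) (i : ℤ) : Type u :=
  (K.X i).obj ⧸ LinearMap.range (lin (K.d (i - 1) i))

/-- `C^i(X)` is the quotient `X^i / Im d^{i-1}`. -/
def cokerEquiv (K : CxProj R) (i : ℤ) : coker (toK K) i ≃ₗ[Rᵐᵒᵖ] CokerMod K i :=
  (ModuleCat.cokernelIsoRangeQuotient (K.d (i - 1) i).hom).toLinearEquiv

lemma cokerMod_mk_eq_zero_iff {K : CxProj R} {i : ℤ} (x : (K.X i).obj) :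
    (LinearMap.range (lin (K.d (i - 1) i))).mkQ x = 0 ↔ ∃ y, lin (K.d (i - 1) i) y = x := by
  simp

lemma homotopy_apply {K L : CxProj R} {f g : K ⟶ L} (h : Homotopy f g) (i : ℤ)
    (x : (K.X i).obj) :
    lin (f.f i) x = lin (h.hom (i + 1) i) (lin (K.d i (i + 1)) x) +
      lin (L.d (i - 1) i) (lin (h.hom i (i - 1)) x) + lin (g.f i) x := by
  rw [h.comm i, dNext_eq h.hom (show (ComplexShape.up ℤ).Rel i (i + 1) by simp),
    prevD_eq h.hom (show (ComplexShape.up ℤ).Rel (i - 1) i by simp)]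
  simp

/-- If `K` is a retract of `L` in the homotopy category, then `C^i(K)` is a retract
of `C^i(L) ⊕ K^{i+1}`. -/
lemma exists_retract_cokerMod {K L : CxProj R} (f : K ⟶ L) (g : L ⟶ K)
    (h : Homotopy (f ≫ g) (𝟙 K)) (i : ℤ) :
    ∃ (s : CokerMod K i →ₗ[Rᵐᵒᵖ] CokerMod L i × (K.X (i + 1)).obj)
      (r : CokerMod L i × (K.X (i + 1)).obj →ₗ[Rᵐᵒᵖ] CokerMod K i), ∀ x, r (s x) = x := by
  have hf : LinearMap.range (lin (K.d (i - 1) i)) ≤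
      LinearMap.ker ((LinearMap.range (lin (L.d (i - 1) i))).mkQ ∘ₗ lin (f.f i)) := by
    rintro _ ⟨x, rfl⟩
    exact (cokerMod_mk_eq_zero_iff _).2 ⟨lin (f.f (i - 1)) x, (lin_f_d f _ _ x).symm⟩
  have hg : LinearMap.range (lin (L.d (i - 1) i)) ≤
      LinearMap.ker ((LinearMap.range (lin (K.d (i - 1) i))).mkQ ∘ₗ lin (g.f i)) := by
    rintro _ ⟨x, rfl⟩
    exact (cokerMod_mk_eq_zero_iff _).2 ⟨lin (g.f (i - 1)) x, (lin_f_d g _ _ x).symm⟩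
  have hd : LinearMap.range (lin (K.d (i - 1) i)) ≤ LinearMap.ker (lin (K.d i (i + 1))) := by
    rintro _ ⟨x, rfl⟩
    exact lin_d_d K _ _ _ x
  -- The homotopy formula is $gf=\mathrm{id}+hd+dh$. Modulo boundaries $dh$ vanishes, and $hd$ is
  -- cancelled by recording $d$ in $K^{i+1}$ and applying $-h$.
  refine ⟨(Submodule.liftQ _ _ hf).prod (Submodule.liftQ _ _ hd),
    (Submodule.liftQ _ _ hg).coprod
      (-((LinearMap.range (lin (K.d (i - 1) i))).mkQ ∘ₗ lin (h.hom (i + 1) i))), fun x => ?_⟩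
  obtain ⟨x, rfl⟩ := Submodule.mkQ_surjective _ x
  have key := homotopy_apply h i x
  have h0 : (LinearMap.range (lin (K.d (i - 1) i))).mkQ
      (lin (K.d (i - 1) i) (lin (h.hom i (i - 1)) x)) = 0 :=
    (cokerMod_mk_eq_zero_iff _).2 ⟨_, rfl⟩
  have key' := congrArg (LinearMap.range (lin (K.d (i - 1) i))).mkQ key
  rw [map_add, map_add, h0, add_zero] at key'
  change (LinearMap.range (lin (K.d (i - 1) i))).mkQ (lin (g.f i) (lin (f.f i) x)) +
    -((LinearMap.range (lin (K.d (i - 1) i))).mkQ (lin (h.hom (i + 1) i)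
      (lin (K.d i (i + 1)) x))) = _
  rw [HomologicalComplex.comp_f, lin_comp] at key'
  rw [key']
  simp

lemma exists_retract_coker {X Y : KProj R} (f : X ⟶ Y) (g : Y ⟶ X) (h : f ≫ g = 𝟙 X) (i : ℤ) :
    ∃ (s : coker X i →ₗ[Rᵐᵒᵖ] coker Y i × (X.as.X (i + 1)).obj)
      (r : coker Y i × (X.as.X (i + 1)).obj →ₗ[Rᵐᵒᵖ] coker X i), ∀ x, r (s x) = x := by
  obtain ⟨K, rfl⟩ := HomotopyCategory.quotient_obj_surjective X
  obtain ⟨L, rfl⟩ := HomotopyCategory.quotient_obj_surjective Y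
  obtain ⟨f, rfl⟩ := (HomotopyCategory.quotient _ _).map_surjective f
  obtain ⟨g, rfl⟩ := (HomotopyCategory.quotient _ _).map_surjective g
  obtain ⟨s, r, hrs⟩ := exists_retract_cokerMod f g
    (HomotopyCategory.homotopyOfEq _ _ (by simpa using h)) i
  exact exists_retract_congr (cokerEquiv K i)
    ((cokerEquiv L i).prodCongr (LinearEquiv.refl Rᵐᵒᵖ (K.X (i + 1)).obj)) hrs

lemma GdimLE.coker_of_retract {n : ℕ} {X Y : KProj R} (f : X ⟶ Y) (g : Y ⟶ X)
    (h : f ≫ g = 𝟙 X) (i : ℤ) (hY : GdimLE R n (coker Y i)) : GdimLE R n (coker X i) := by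
  obtain ⟨s, r, hrs⟩ := exists_retract_coker f g h i
  exact (hY.prod_projective (P := (X.as.X (i + 1)).obj)).of_retract s r hrs

/-- The module $C^i$ is not a homotopy invariant, but its Gorenstein dimension is, as projective
summands do not affect the bound. -/
lemma gdimLE_coker_iff_of_iso {n : ℕ} {X Y : KProj R} (e : X ≅ Y) (i : ℤ) :
    GdimLE R n (coker X i) ↔ GdimLE R n (coker Y i) :=
  ⟨GdimLE.coker_of_retract e.inv e.hom e.inv_hom_id i,
    GdimLE.coker_of_retract e.hom e.inv e.hom_inv_id i⟩

/-- Elementwise surjectivity in cohomology. -/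
def ElemSurjective {K L : CxProj R} (f : K ⟶ L) : Prop :=
  ∀ (i : ℤ) (x : (L.X i).obj), lin (L.d i (i + 1)) x = 0 →
    ∃ (y : (K.X i).obj) (z : (L.X (i - 1)).obj), lin (K.d i (i + 1)) y = 0 ∧
      x = lin (f.f i) y + lin (L.d (i - 1) i) z

lemma cohSurjective_iff_epi {K L : CxProj R} (f : K ⟶ L) :
    CohSurjective ((HomotopyCategory.quotient _ _).map f) ↔
      ∀ i, Epi (HomologicalComplex.homologyMap
        (((isFGProj R).ι.mapHomologicalComplex _).map f) i) := by
  refine forall_congr' fun i => ?_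
  rw [← ModuleCat.epi_iff_surjective]
  let F := HomotopyCategory.homologyFunctorFactors (ModuleCat.{u} Rᵐᵒᵖ) (ComplexShape.up ℤ) i
  exact (MorphismProperty.epimorphisms _).arrow_mk_iso_iff
    (Arrow.isoMk (F.app _) (F.app _) (F.hom.naturality
      (((isFGProj R).ι.mapHomologicalComplex _).map f)).symm)

lemma cohSurjective_iff {K L : CxProj R} (f : K ⟶ L) :
    CohSurjective ((HomotopyCategory.quotient _ _).map f) ↔ ElemSurjective f := by
  rw [cohSurjective_iff_epi]
  refine forall_congr' fun i => ?_
  rw [HomologicalComplex.epi_homologyMap_iff_up_to_refinements _ (i - 1) i (i + 1)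
    (by simp) (by simp)]
  constructor
  · intro h x hx
    obtain ⟨A', π, hπ, y, hy, z, hyz⟩ := h
      (A := ModuleCat.of Rᵐᵒᵖ (LinearMap.ker (lin (L.d i (i + 1)))))
      (ModuleCat.ofHom (LinearMap.ker (lin (L.d i (i + 1)))).subtype) (by
        ext x
        exact x.2)
    obtain ⟨a, ha⟩ := (ModuleCat.epi_iff_surjective _).1 hπ ⟨x, hx⟩
    refine ⟨y a, z a, congrArg (fun φ => φ.hom a) hy, ?_⟩
    have := congrArg (fun φ => φ.hom a) hyz
    change (π a).1 = _ at this
    rw [ha] at this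
    exact this
  · intro h A y₂ hy₂
    let l : A →ₗ[Rᵐᵒᵖ] (L.X i).obj := y₂.hom
    -- The refinement of `A` consists of all triples $(a,y,z)$ with $dy=0$ and $l(a)=f(y)+d(z)$; the
    -- elementwise condition makes it surject onto `A`.
    let W := LinearMap.ker ((((lin (K.d i (i + 1))) ∘ₗ LinearMap.fst _ _ _ ∘ₗ LinearMap.snd _ _ _).prod
      (l ∘ₗ LinearMap.fst _ _ _ - (lin (f.f i)) ∘ₗ LinearMap.fst _ _ _ ∘ₗ LinearMap.snd _ _ _ -
        (lin (L.d (i - 1) i)) ∘ₗ LinearMap.snd _ _ _ ∘ₗ LinearMap.snd _ _ _) :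
      A × (K.X i).obj × (L.X (i - 1)).obj →ₗ[Rᵐᵒᵖ] (K.X (i + 1)).obj × (L.X i).obj))
    have hW : ∀ w : W, lin (K.d i (i + 1)) w.1.2.1 = 0 ∧
        l w.1.1 - lin (f.f i) w.1.2.1 - lin (L.d (i - 1) i) w.1.2.2 = 0 := fun w =>
      Prod.ext_iff.1 w.2
    refine ⟨ModuleCat.of Rᵐᵒᵖ W, ModuleCat.ofHom (LinearMap.fst _ _ _ ∘ₗ W.subtype), ?_,
      ModuleCat.ofHom (LinearMap.fst _ _ _ ∘ₗ LinearMap.snd _ _ _ ∘ₗ W.subtype), ?_,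
      ModuleCat.ofHom (LinearMap.snd _ _ _ ∘ₗ LinearMap.snd _ _ _ ∘ₗ W.subtype), ?_⟩
    · rw [ModuleCat.epi_iff_surjective]
      intro a
      obtain ⟨y, z, hy, hyz⟩ := h (y₂.hom a) (congrArg (fun φ => φ.hom a) hy₂)
      refine ⟨⟨(a, y, z), ?_⟩, rfl⟩
      refine Prod.ext hy ?_
      change l a - lin (f.f i) y - lin (L.d (i - 1) i) z = 0
      have hyz' : l a = _ := hyz
      rw [hyz']
      abel
    · ext w
      exact (hW w).1
    · ext w
      have := (hW w).2
      rw [sub_sub, sub_eq_zero] at this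
      exact this

/-- A homotopy between maps from a complex with zero differential. -/
def homotopyOfDEqZero {P L : CxProj R} (hP : ∀ i j, P.d i j = 0) {f g : P ⟶ L}
    (v : ∀ i, P.X i ⟶ L.X (i - 1))
    (hv : ∀ i x, lin (f.f i) x = lin (L.d (i - 1) i) (lin (v i) x) + lin (g.f i) x) :
    Homotopy f g where
  hom i j := if h : i - 1 = j then v i ≫ (L.XIsoOfEq h).hom else 0
  zero i j hij := by
    rw [dif_neg]
    intro h
    exact hij (by simp [← h])
  comm i := by
    rw [dNext_eq _ (show (ComplexShape.up ℤ).Rel i (i + 1) by simp),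
      prevD_eq _ (show (ComplexShape.up ℤ).Rel (i - 1) i by simp), hP]
    refine lin_injective fun x => ?_
    simpa using hv i x

/-- Maps from a complex of projectives with zero differential lift, up to homotopy, through maps
which are surjective in cohomology. -/
lemma exists_lift_of_d_eq_zero {P K L : CxProj R} (hP : ∀ i j, P.d i j = 0) (f : K ⟶ L)
    (hf : ElemSurjective f) (g : P ⟶ L) : ∃ t : P ⟶ K, Nonempty (Homotopy (t ≫ f) g) := by
  have key : ∀ i, ∃ (t : (P.X i).obj →ₗ[Rᵐᵒᵖ] (K.X i).obj)
      (v : (P.X i).obj →ₗ[Rᵐᵒᵖ] (L.X (i - 1)).obj), ∀ x, lin (K.d i (i + 1)) (t x) = 0 ∧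
        lin (f.f i) (t x) = lin (L.d (i - 1) i) (v x) + lin (g.f i) x := by
    intro i
    let Z := LinearMap.ker (lin (K.d i (i + 1)))
    let Z' := LinearMap.ker (lin (L.d i (i + 1)))
    -- Surjectivity on $H^i$ means that $(y,z)\mapsto f(y)-d(z)$ is onto the cocycles of `L`.
    -- Lifting `g` through it yields the chain map and the homotopy together.
    let p : Z × (L.X (i - 1)).obj →ₗ[Rᵐᵒᵖ] Z' := LinearMap.codRestrict Z'
      ((lin (f.f i) ∘ₗ Z.subtype).coprod (-lin (L.d (i - 1) i))) (by
        rintro ⟨⟨y, hy⟩, z⟩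
        have hy' : lin (K.d i (i + 1)) y = 0 := hy
        simp [Z', ← lin_f_d, hy'])
    have hp : Function.Surjective p := by
      rintro ⟨x, hx⟩
      obtain ⟨y, z, hy, hyz⟩ := hf i x hx
      exact ⟨(⟨y, hy⟩, -z), Subtype.ext (by simp [p, hyz])⟩
    let γ : (P.X i).obj →ₗ[Rᵐᵒᵖ] Z' := LinearMap.codRestrict Z' (lin (g.f i)) (by
      intro x
      change lin (L.d i (i + 1)) (lin (g.f i) x) = 0
      rw [← lin_f_d, hP, lin_zero, map_zero])
    obtain ⟨l, hl⟩ := Module.projective_lifting_property p γ hp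
    refine ⟨Z.subtype ∘ₗ LinearMap.fst _ _ _ ∘ₗ l, LinearMap.snd _ _ _ ∘ₗ l,
      fun x => ⟨(l x).1.2, ?_⟩⟩
    have := congrArg Subtype.val (LinearMap.congr_fun hl x)
    have h2 : lin (f.f i) (l x).1.1 + -lin (L.d (i - 1) i) (l x).2 = lin (g.f i) x := this
    change lin (f.f i) (l x).1.1 = lin (L.d (i - 1) i) (l x).2 + lin (g.f i) x
    rw [← h2]
    abel
  choose t v htv using key
  refine ⟨{ f := fun i => homOfLin (t i), comm' := ?_ },
    ⟨homotopyOfDEqZero hP (fun i => homOfLin (v i)) fun i x => (htv i x).2⟩⟩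
  rintro i j (rfl : i + 1 = j)
  refine lin_injective fun x => ?_
  rw [hP]
  simpa using (htv i x).1

/-! ### Cokernels of mapping cones -/

section Cone

open CochainComplex HomComplex

variable {K L : CxProj R} (φ : K ⟶ L)

lemma exists_mappingCone_eq (i j : ℤ) (hij : i + 1 = j) (c : ((mappingCone φ).X i).obj) :
    ∃ (y : (K.X j).obj) (g : (L.X i).obj),
      c = lin ((mappingCone.inl φ).v j i (by lia)) y + lin ((mappingCone.inr φ).f i) g :=
  ⟨_, _, (congrArg (fun ψ => lin ψ c) (mappingCone.id_X φ i j hij)).symm⟩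

lemma mappingCone_d_inl (i j k : ℤ) (hij : i + 1 = j) (hjk : j + 1 = k) (y : (K.X j).obj) :
    lin ((mappingCone φ).d i j) (lin ((mappingCone.inl φ).v j i (by lia)) y) =
      lin ((mappingCone.inr φ).f j) (lin (φ.f j) y) -
        lin ((mappingCone.inl φ).v k j (by lia)) (lin (K.d j k) y) :=
  congrArg (fun ψ => lin ψ y) (mappingCone.inl_v_d φ j i k (by lia) (by lia))

lemma mappingCone_eq_iff (i j : ℤ) (hij : i + 1 = j) (y y' : (K.X j).obj) (g g' : (L.X i).obj) :
    lin ((mappingCone.inl φ).v j i (by lia)) y + lin ((mappingCone.inr φ).f i) g =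
      lin ((mappingCone.inl φ).v j i (by lia)) y' + lin ((mappingCone.inr φ).f i) g' ↔
      y = y' ∧ g = g' := by
  constructor
  · intro h
    have e1 : ∀ y, lin ((mappingCone.fst φ).1.v i j hij)
        (lin ((mappingCone.inl φ).v j i (by lia)) y) = y := fun y =>
      congrArg (fun ψ => lin ψ y) (mappingCone.inl_v_fst_v φ j i hij)
    have e2 : ∀ y, lin ((mappingCone.snd φ).v i i (add_zero i))
        (lin ((mappingCone.inl φ).v j i (by lia)) y) = 0 := fun y =>
      congrArg (fun ψ => lin ψ y) (mappingCone.inl_v_snd_v φ j i (by lia))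
    have e3 : ∀ y, lin ((mappingCone.fst φ).1.v i j hij)
        (lin ((mappingCone.inr φ).f i) y) = 0 := fun y =>
      congrArg (fun ψ => lin ψ y) (mappingCone.inr_f_fst_v φ i j hij)
    have e4 : ∀ y, lin ((mappingCone.snd φ).v i i (add_zero i))
        (lin ((mappingCone.inr φ).f i) y) = y := fun y =>
      congrArg (fun ψ => lin ψ y) (mappingCone.inr_f_snd_v φ i)
    have h1 := congrArg (lin ((mappingCone.fst φ).1.v i j hij)) h
    have h2 := congrArg (lin ((mappingCone.snd φ).v i i (add_zero i))) h
    simp only [map_add, e1, e3, add_zero] at h1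
    simp only [map_add, e2, e4, zero_add] at h2
    exact ⟨h1, h2⟩
  · rintro ⟨rfl, rfl⟩
    rfl

/-- If `L ⟶ Cone(φ)` is surjective in cohomology, then `C^i(Cone φ)` is the cokernel of an
injective map `C^i(K) ⟶ C^i(L) ⊕ K^{i+1}`. -/
lemma exists_isShortExact_cokerMod (h : ElemSurjective (mappingCone.inr φ)) (i : ℤ) :
    ∃ (α : CokerMod K i →ₗ[Rᵐᵒᵖ] CokerMod L i × (K.X (i + 1)).obj)
      (β : CokerMod L i × (K.X (i + 1)).obj →ₗ[Rᵐᵒᵖ] CokerMod (mappingCone φ) i),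
      IsShortExact α β := by
  have hφ : LinearMap.range (lin (K.d (i - 1) i)) ≤
      LinearMap.ker ((LinearMap.range (lin (L.d (i - 1) i))).mkQ ∘ₗ lin (φ.f i)) := by
    rintro _ ⟨x, rfl⟩
    exact (cokerMod_mk_eq_zero_iff _).2 ⟨lin (φ.f (i - 1)) x, (lin_f_d φ _ _ x).symm⟩
  have hd : LinearMap.range (lin (K.d (i - 1) i)) ≤ LinearMap.ker (-lin (K.d i (i + 1))) := by
    rintro _ ⟨x, rfl⟩
    simp
  let q := (LinearMap.range (lin ((mappingCone φ).d (i - 1) i))).mkQ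
  have hr : LinearMap.range (lin (L.d (i - 1) i)) ≤
      LinearMap.ker (q ∘ₗ lin ((mappingCone.inr φ).f i)) := by
    rintro _ ⟨x, rfl⟩
    exact (cokerMod_mk_eq_zero_iff _).2
      ⟨lin ((mappingCone.inr φ).f (i - 1)) x, (lin_f_d (mappingCone.inr φ) _ _ x).symm⟩
  -- The maps are $(\varphi,-d)$ and the sum of the two inclusions into the cone. Only injectivity
  -- of the first uses the hypothesis on cohomology.
  refine ⟨(Submodule.liftQ _ _ hφ).prod (Submodule.liftQ _ _ hd),
    (Submodule.liftQ _ _ hr).coprod (q ∘ₗ lin ((mappingCone.inl φ).v (i + 1) i (by lia))),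
    ?_, ?_, ?_⟩
  · rw [injective_iff_map_eq_zero]
    intro y hy
    obtain ⟨y, rfl⟩ := Submodule.mkQ_surjective _ y
    obtain ⟨g, hg⟩ := (cokerMod_mk_eq_zero_iff _).1 (congrArg Prod.fst hy)
    have hy0 : lin (K.d i (i + 1)) y = 0 := neg_eq_zero.1 (congrArg Prod.snd hy)
    -- The relations $\varphi(y)=d(g)$ and $dy=0$ make $(y,-g)$ a cocycle of the cone in degree
    -- $i-1$. It is cohomologous to a cocycle from `L`, so its `K`-component `y` is a boundary.
    have hcyc : lin ((mappingCone φ).d (i - 1) i)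
        (lin ((mappingCone.inl φ).v i (i - 1) (by lia)) y -
          lin ((mappingCone.inr φ).f (i - 1)) g) = 0 := by
      rw [map_sub, mappingCone_d_inl φ (i - 1) i (i + 1) (by lia) rfl, ← lin_f_d, hg, hy0]
      simp
    have h' := h (i - 1)
    rw [show i - 1 + 1 = i by lia] at h'
    obtain ⟨l, c, hl, hlc⟩ := h' _ hcyc
    obtain ⟨y', g', rfl⟩ := exists_mappingCone_eq φ (i - 1 - 1) (i - 1) (by lia) c
    rw [map_add, mappingCone_d_inl φ (i - 1 - 1) (i - 1) i (by lia) (by lia), ← lin_f_d] at hlc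
    have hfin : y = -lin (K.d (i - 1) i) y' := by
      refine ((mappingCone_eq_iff φ (i - 1) i (by lia) y _ (-g)
        (l + lin (φ.f (i - 1)) y' + lin (L.d (i - 1 - 1) (i - 1)) g')).1 ?_).1
      rw [map_neg, ← sub_eq_add_neg, hlc]
      simp only [map_add, map_neg]
      abel
    exact (cokerMod_mk_eq_zero_iff _).2 ⟨-y', by rw [map_neg, ← hfin]⟩
  · rintro ⟨g, y⟩
    obtain ⟨g, rfl⟩ := Submodule.mkQ_surjective _ g
    constructor
    · intro h0
      have h0' : q (lin ((mappingCone.inr φ).f i) g +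
          lin ((mappingCone.inl φ).v (i + 1) i (by lia)) y) = 0 := by
        rw [map_add]; exact h0
      obtain ⟨c, hc⟩ := (cokerMod_mk_eq_zero_iff _).1 h0'
      obtain ⟨y', g', rfl⟩ := exists_mappingCone_eq φ (i - 1) i (by lia) c
      rw [map_add, mappingCone_d_inl φ (i - 1) i (i + 1) (by lia) rfl, ← lin_f_d] at hc
      have := (mappingCone_eq_iff φ i (i + 1) rfl (-lin (K.d i (i + 1)) y') y
        (lin (φ.f i) y' + lin (L.d (i - 1) i) g') g).1 (by
          rw [add_comm _ (lin _ g), ← hc]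
          simp only [map_add, map_neg]
          abel)
      refine ⟨(LinearMap.range (lin (K.d (i - 1) i))).mkQ y', ?_⟩
      refine Prod.ext ?_ this.1
      change (LinearMap.range (lin (L.d (i - 1) i))).mkQ (lin (φ.f i) y') = _
      rw [← this.2, map_add, (cokerMod_mk_eq_zero_iff (lin (L.d (i - 1) i) g')).2 ⟨_, rfl⟩,
        add_zero]
    · rintro ⟨y', h'⟩
      obtain ⟨y', rfl⟩ := Submodule.mkQ_surjective _ y'
      rw [← h']
      change q (lin ((mappingCone.inr φ).f i) (lin (φ.f i) y')) +
        q (lin ((mappingCone.inl φ).v (i + 1) i (by lia)) (-lin (K.d i (i + 1)) y')) = 0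
      rw [← map_add, map_neg, ← sub_eq_add_neg,
        ← mappingCone_d_inl φ (i - 1) i (i + 1) (by lia) rfl]
      exact (cokerMod_mk_eq_zero_iff _).2 ⟨_, rfl⟩
  · intro c
    obtain ⟨c, rfl⟩ := Submodule.mkQ_surjective _ c
    obtain ⟨y, g, rfl⟩ := exists_mappingCone_eq φ i (i + 1) rfl c
    refine ⟨((LinearMap.range (lin (L.d (i - 1) i))).mkQ g, y), ?_⟩
    change q _ + q _ = _
    rw [← map_add, add_comm]
    rfl

end Cone

lemma CohSurjective.comp_iso {X Y Z : KProj R} {f : X ⟶ Y} (hf : CohSurjective f) (e : Y ≅ Z) :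
    CohSurjective (f ≫ e.hom) := by
  intro i
  rw [← ModuleCat.epi_iff_surjective, Functor.map_comp]
  have := (ModuleCat.epi_iff_surjective _).2 (hf i)
  exact epi_comp _ _

/-- A triangle on a cohomologically surjective map induces short exact sequences
of cokernels, up to finitely generated projective summands. -/
lemma exists_isShortExact_coker {Y G X : KProj R} {a : Y ⟶ G} {f : G ⟶ X} {h : X ⟶ Y⟦(1 : ℤ)⟧}
    (hT : Pretriangulated.Triangle.mk a f h ∈ distTriang (KProj R)) (hf : CohSurjective f) :
    ∃ (Z : KProj R), Nonempty (X ≅ Z) ∧ ∀ i : ℤ,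
      ∃ (α : coker Y i →ₗ[Rᵐᵒᵖ] coker G i × (Y.as.X (i + 1)).obj)
        (β : coker G i × (Y.as.X (i + 1)).obj →ₗ[Rᵐᵒᵖ] coker Z i), IsShortExact α β := by
  obtain ⟨K, rfl⟩ := HomotopyCategory.quotient_obj_surjective Y
  obtain ⟨L, rfl⟩ := HomotopyCategory.quotient_obj_surjective G
  obtain ⟨φ, rfl⟩ := (HomotopyCategory.quotient _ _).map_surjective a
  have hT' := HomotopyCategory.mappingCone_triangleh_distinguished φ
  -- The comparison is the identity on `Y` and `G`, so `f` becomes the inclusion into the cone, and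
  -- that inclusion is cohomologically surjective.
  let e := Pretriangulated.isoTriangleOfIso₁₂ _ _ hT hT' (Iso.refl _) (Iso.refl _)
    ((Category.comp_id _).trans (Category.id_comp _).symm)
  let e₃ : X ≅ toK (CochainComplex.mappingCone φ) := Pretriangulated.Triangle.π₃.mapIso e
  have hcomm : f ≫ e₃.hom = (HomotopyCategory.quotient _ _).map
      (CochainComplex.mappingCone.inr φ) := by
    have := e.hom.comm₂
    have h2 : e.hom.hom₂ = 𝟙 _ := rfl
    rw [h2] at this
    exact this.trans (Category.id_comp _)
  have hsurj := hf.comp_iso e₃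
  rw [hcomm, cohSurjective_iff] at hsurj
  refine ⟨_, ⟨e₃⟩, fun i => ?_⟩
  obtain ⟨α, β, hαβ⟩ := exists_isShortExact_cokerMod φ hsurj i
  exact ⟨_, _, hαβ.conj (cokerEquiv K i)
    ((cokerEquiv L i).prodCongr (LinearEquiv.refl Rᵐᵒᵖ (K.X (i + 1)).obj))
    (cokerEquiv (CochainComplex.mappingCone φ) i)⟩

end Complexes

/-! ### $\operatorname{Add}R$ and its approximations -/

section AddR

variable {R : Type u} [Ring R]

/-- Maps from `W` factor through all cohomologically surjective maps. -/
def LiftsThroughCohSurjective : ObjectProperty (KProj R) := fun W =>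
  ∀ (Y Z : KProj R) (f : Y ⟶ Z), CohSurjective f → ∀ g : W ⟶ Z, ∃ t : W ⟶ Y, t ≫ f = g

lemma LiftsThroughCohSurjective.of_retract {W V : KProj R} (hV : LiftsThroughCohSurjective V)
    (r : Retract W V) : LiftsThroughCohSurjective W := by
  intro Y Z f hf g
  obtain ⟨t, ht⟩ := hV Y Z f hf (r.r ≫ g)
  exact ⟨r.i ≫ t, by rw [Category.assoc, ht, r.retract_assoc]⟩

lemma liftsThroughCohSurjective_of_d_eq_zero {P : CxProj R} (hP : ∀ i j, P.d i j = 0) :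
    LiftsThroughCohSurjective (toK P) := by
  intro Y Z f hf g
  obtain ⟨K, rfl⟩ := HomotopyCategory.quotient_obj_surjective Y
  obtain ⟨L, rfl⟩ := HomotopyCategory.quotient_obj_surjective Z
  obtain ⟨f, rfl⟩ := (HomotopyCategory.quotient _ _).map_surjective f
  obtain ⟨g, rfl⟩ := (HomotopyCategory.quotient _ _).map_surjective g
  obtain ⟨t, ⟨h⟩⟩ := exists_lift_of_d_eq_zero hP f ((cohSurjective_iff f).1 hf) g
  exact ⟨(HomotopyCategory.quotient _ _).map t, by
    rw [← Functor.map_comp]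
    exact HomotopyCategory.eq_of_homotopy _ _ h⟩

/-- Quantifying over all shifts makes the class shift-stable. For coproducts only the universal
property is used: lifts on the summands glue. -/
lemma isAddClosed_liftsThroughCohSurjective :
    IsAddClosed (fun X : KProj R => ∀ i : ℤ, LiftsThroughCohSurjective (X⟦i⟧)) where
  ring i := by
    let P := (HomologicalComplex.single (ProjCat R) (ComplexShape.up ℤ) 0).obj (ringObj R)
    have e : (ringComplex R)⟦i⟧ ≅ toK (P⟦i⟧) :=
      (((HomotopyCategory.quotient (ProjCat R) (ComplexShape.up ℤ)).commShiftIso i).app P).symm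
    refine (liftsThroughCohSurjective_of_d_eq_zero ?_).of_retract (Retract.ofIso e)
    intro j k
    rw [CochainComplex.shiftFunctor_obj_d']
    simp [P]
    rfl
  shift X i hX j :=
    (hX (i + j)).of_retract (Retract.ofIso ((shiftFunctorAdd (KProj R) i j).app X).symm)
  summand X Y h hY i := by
    obtain ⟨r⟩ := h
    exact (hY i).of_retract (r.map (shiftFunctor (KProj R) i))
  coproduct J F c hc hF i := by
    obtain ⟨hc⟩ := hc
    have hc' := isColimitCofanMkObjOfIsColimit (shiftFunctor (KProj R) i) F _
      (hc.ofIsoColimit (Cofan.ext (Iso.refl _) : c ≅ Cofan.mk c.pt c.inj))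
    intro Y Z f hf g
    choose t ht using fun j => hF j i Y Z f hf ((c.inj j)⟦i⟧' ≫ g)
    refine ⟨Cofan.IsColimit.desc hc' t, Cofan.IsColimit.hom_ext hc' _ _ fun j => ?_⟩
    rw [Cofan.IsColimit.fac_assoc, ht]
    rfl

lemma AddR.lifts {W : KProj R} (hW : AddR R W) : LiftsThroughCohSurjective W :=
  (hW _ isAddClosed_liftsThroughCohSurjective 0).of_retract
    (Retract.ofIso ((shiftFunctorZero (KProj R) ℤ).app W).symm)

lemma isAddClosed_addR : IsAddClosed (AddR R) where
  ring _ h := h.ring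
  shift X i hX 𝒳 h := h.shift X i (hX 𝒳 h)
  summand X Y r hY 𝒳 h := h.summand X Y r (hY 𝒳 h)
  coproduct J F c hc hF 𝒳 h := h.coproduct J F c hc fun j => hF j 𝒳 h

lemma AddR.of_iso {X Y : KProj R} (hX : AddR R X) (e : X ≅ Y) : AddR R Y :=
  isAddClosed_addR.summand _ _ ⟨Retract.ofIso e.symm⟩ hX

variable (R) in
/-- `R` as a complex concentrated in degree `i`. -/
abbrev stalk (i : ℤ) : CxProj R :=
  (HomologicalComplex.single (ProjCat R) (ComplexShape.up ℤ) i).obj (ringObj R)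

lemma addR_stalk (i : ℤ) : AddR R (toK (stalk R i)) := by
  have e₁ : toK ((stalk R 0)⟦-i⟧) ≅ (ringComplex R)⟦-i⟧ :=
    ((HomotopyCategory.quotient (ProjCat R) (ComplexShape.up ℤ)).commShiftIso (-i)).app (stalk R 0)
  have e₂ : (stalk R 0)⟦-i⟧ ≅ stalk R i :=
    ((CochainComplex.singleFunctors (ProjCat R)).shiftIso (-i) i 0 (by lia)).app (ringObj R)
  exact (isAddClosed_addR.shift _ (-i) isAddClosed_addR.ring).of_iso
    (e₁.symm ≪≫ (HomotopyCategory.quotient _ _).mapIso e₂)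

variable (R) in
/-- A finitely generated free right module as an object of `proj R`. -/
def freeObj (n : ℕ) : ProjCat R :=
  ⟨ModuleCat.of Rᵐᵒᵖ (Fin n → R), by
    have e : (Fin n → R) ≃ₗ[Rᵐᵒᵖ] (Fin n → Rᵐᵒᵖ) :=
      LinearEquiv.piCongrRight fun _ => MulOpposite.opLinearEquiv Rᵐᵒᵖ (M := R)
    exact ⟨Module.Finite.equiv e.symm, Module.Projective.of_equiv' e.symm⟩⟩

variable (R) in
/-- The complex with zero differential and components `R^{n i}`. -/
abbrev freeCx (n : ℤ → ℕ) : CxProj R where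
  X i := freeObj R (n i)
  d _ _ := 0

/-- The map out of a free module given by its restrictions to the coordinates. -/
def freeDesc {n : ℕ} {A : ProjCat R} (φ : Fin n → (ringObj R ⟶ A)) : freeObj R n ⟶ A :=
  homOfLin (LinearMap.lsum Rᵐᵒᵖ (fun _ : Fin n => R) ℕ fun k => lin (φ k))

/-- The inclusion of a coordinate in a free module. -/
def freeInj {n : ℕ} (k : Fin n) : ringObj R ⟶ freeObj R n :=
  homOfLin (LinearMap.single Rᵐᵒᵖ (fun _ : Fin n => R) k)

lemma freeInj_freeDesc {n : ℕ} {A : ProjCat R} (φ : Fin n → (ringObj R ⟶ A)) (k : Fin n) :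
    freeInj k ≫ freeDesc φ = φ k := by
  refine lin_injective fun (x : R) => ?_
  have := LinearMap.lsum_piSingle (S := ℕ) (R := Rᵐᵒᵖ) (φ := fun _ : Fin n => R)
    (fun k => lin (φ k)) k x
  exact this

lemma freeInj_freeDesc_assoc {n : ℕ} {A B : ProjCat R} (φ : Fin n → (ringObj R ⟶ A)) (k : Fin n)
    (ψ : A ⟶ B) : freeInj k ≫ freeDesc φ ≫ ψ = φ k ≫ ψ := by
  rw [← Category.assoc, freeInj_freeDesc]

lemma freeObj_hom_ext {n : ℕ} {A : ProjCat R} {φ ψ : freeObj R n ⟶ A}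
    (h : ∀ k, freeInj k ≫ φ = freeInj k ≫ ψ) : φ = ψ := by
  have : lin φ = lin ψ := LinearMap.pi_ext' (φ := fun _ : Fin n => R) fun k => by
    ext
    exact congrArg (fun χ => lin χ (1 : R)) (h k)
  exact lin_injective fun x => LinearMap.congr_fun this x

/-- The inclusion of a copy of `R` in `freeCx R n`. -/
def stalkInj (n : ℤ → ℕ) (i : ℤ) (k : Fin (n i)) : stalk R i ⟶ freeCx R n :=
  HomologicalComplex.mkHomFromSingle (freeInj k) fun _ _ => comp_zero

/-- The restriction of a map to a copy of `R` in degree `i`. -/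
def stalkEval {L : CxProj R} {i : ℤ} (σ : stalk R i ⟶ L) : ringObj R ⟶ L.X i :=
  (HomologicalComplex.singleObjXSelf (ComplexShape.up ℤ) i (ringObj R)).inv ≫ σ.f i

lemma stalkEval_stalkInj_comp {L : CxProj R} {n : ℤ → ℕ} {i : ℤ} (k : Fin (n i))
    (m : freeCx R n ⟶ L) : stalkEval (stalkInj n i k ≫ m) = freeInj k ≫ m.f i := by
  have h : (stalkInj n i k).f i = (HomologicalComplex.singleObjXSelf (ComplexShape.up ℤ) i
      (ringObj R)).hom ≫ freeInj k := HomologicalComplex.mkHomFromSingle_f _ _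
  rw [stalkEval, HomologicalComplex.comp_f, h, Category.assoc, Iso.inv_hom_id_assoc]

lemma stalkEval_comp_d {L : CxProj R} {i : ℤ} (σ : stalk R i ⟶ L) (j : ℤ) :
    stalkEval σ ≫ L.d i j = 0 := by
  simp [stalkEval]

lemma stalk_hom_ext {L : CxProj R} {i : ℤ} {σ τ : stalk R i ⟶ L}
    (h : stalkEval σ = stalkEval τ) : σ = τ :=
  HomologicalComplex.from_single_hom_ext ((cancel_epi _).1 h)

/-- The map out of `freeCx R n` given by maps on all the copies of `R`. -/
def freeCxDesc {n : ℤ → ℕ} {L : CxProj R} (σ : ∀ i, Fin (n i) → (stalk R i ⟶ L)) :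
    freeCx R n ⟶ L where
  f i := freeDesc fun k => stalkEval (σ i k)
  comm' i j _ := by
    refine (freeObj_hom_ext fun k => ?_).trans zero_comp.symm
    rw [freeInj_freeDesc_assoc, stalkEval_comp_d, comp_zero]

lemma stalkInj_freeCxDesc {n : ℤ → ℕ} {L : CxProj R} (σ : ∀ i, Fin (n i) → (stalk R i ⟶ L))
    (i : ℤ) (k : Fin (n i)) : stalkInj n i k ≫ freeCxDesc σ = σ i k :=
  stalk_hom_ext (by rw [stalkEval_stalkInj_comp]; exact freeInj_freeDesc _ _)

/-- The uniqueness half of the coproduct property in the homotopy category. As the source has zero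
differential, a homotopy is an unconstrained family of maps $R^{n_i}\to L^{i-1}$, assembled from its
coordinates. -/
lemma freeCx_homotopic {n : ℤ → ℕ} {L : CxProj R} (f g : freeCx R n ⟶ L)
    (h : ∀ i k, Nonempty (Homotopy (stalkInj n i k ≫ f) (stalkInj n i k ≫ g))) :
    Nonempty (Homotopy f g) := by
  have key : ∀ i (k : Fin (n i)), ∃ v : ringObj R ⟶ L.X (i - 1),
      freeInj k ≫ f.f i = v ≫ L.d (i - 1) i + freeInj k ≫ g.f i := by
    intro i k
    obtain ⟨H⟩ := h i k
    have := H.comm i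
    rw [dNext_eq H.hom (show (ComplexShape.up ℤ).Rel i (i + 1) by simp),
      prevD_eq H.hom (show (ComplexShape.up ℤ).Rel (i - 1) i by simp),
      HomologicalComplex.single_obj_d, zero_comp, zero_add] at this
    refine ⟨(HomologicalComplex.singleObjXSelf (ComplexShape.up ℤ) i (ringObj R)).inv ≫
      H.hom i (i - 1), ?_⟩
    rw [← stalkEval_stalkInj_comp, ← stalkEval_stalkInj_comp, stalkEval, this, Preadditive.comp_add,
      Category.assoc]
    rfl
  choose v hv using key
  refine ⟨homotopyOfDEqZero (fun _ _ => rfl) (fun i => freeDesc (v i)) fun i x => ?_⟩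
  have : f.f i = freeDesc (v i) ≫ L.d (i - 1) i + g.f i := freeObj_hom_ext fun k => by
    rw [hv, Preadditive.comp_add, freeInj_freeDesc_assoc]
  rw [this, lin_add, lin_comp]

lemma existsUnique_freeCx_desc {n : ℤ → ℕ} {T : KProj R}
    (τ : ∀ i, Fin (n i) → (toK (stalk R i) ⟶ T)) :
    ∃! m : toK (freeCx R n) ⟶ T,
      ∀ i k, (HomotopyCategory.quotient _ _).map (stalkInj n i k) ≫ m = τ i k := by
  obtain ⟨L, rfl⟩ := HomotopyCategory.quotient_obj_surjective T
  choose σ hσ using fun i k => (HomotopyCategory.quotient _ _).map_surjective (τ i k)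
  have hm : ∀ i k, (HomotopyCategory.quotient _ _).map (stalkInj n i k) ≫
      (HomotopyCategory.quotient _ _).map (freeCxDesc σ) = τ i k := fun i k => by
    rw [← Functor.map_comp, stalkInj_freeCxDesc, hσ]
  refine ⟨_, hm, fun m' hm' => ?_⟩
  obtain ⟨μ, rfl⟩ := (HomotopyCategory.quotient _ _).map_surjective m'
  obtain ⟨H⟩ := freeCx_homotopic μ (freeCxDesc σ) fun i k =>
    ⟨HomotopyCategory.homotopyOfEq _ _ (by
      rw [Functor.map_comp, Functor.map_comp, hm]
      exact hm' i k)⟩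
  exact HomotopyCategory.eq_of_homotopy _ _ H

lemma addR_freeCx (n : ℤ → ℕ) : AddR R (toK (freeCx R n)) := by
  -- The summands are indexed in `Type u`, as closure under coproducts requires.
  let J : Type u := ULift.{u} (Σ i : ℤ, Fin (n i))
  let c : Cofan fun j : J => toK (stalk R j.down.1) :=
    Cofan.mk (toK (freeCx R n)) fun j =>
      (HomotopyCategory.quotient _ _).map (stalkInj n j.down.1 j.down.2)
  have key := fun s : Cofan fun j : J => toK (stalk R j.down.1) =>
    existsUnique_freeCx_desc (n := n) fun i k => s.inj ⟨⟨i, k⟩⟩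
  choose m hm huniq using key
  exact isAddClosed_addR.coproduct J _ c
    ⟨Cofan.IsColimit.mk c m (fun s j => hm s j.down.1 j.down.2)
      fun s m' hm' => huniq s m' fun i k => hm' ⟨⟨i, k⟩⟩⟩ fun j => addR_stalk _

lemma CohSurjective.isRightAddApproximation {P X : KProj R} {p : P ⟶ X}
    (hp : CohSurjective p) (hP : AddR R P) : IsRightAddApproximation p :=
  ⟨hP, fun _ hW g => hW.lifts _ _ p hp g⟩

lemma gdimLE_coker_freeCx (n : ℤ → ℕ) (i : ℤ) : GdimLE R 0 (coker (toK (freeCx R n)) i) := by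
  have h : LinearMap.range (lin ((freeCx R n).d (i - 1) i)) = ⊥ := LinearMap.range_zero
  have : GdimLE R 0 ((freeCx R n).X i).obj := fun n => isNGorenstein_of_projective n
  exact this.of_equiv ((cokerEquiv _ i).trans (Submodule.quotEquivOfEqBot _ h))

variable [IsNoetherianRing Rᵐᵒᵖ]

/-- Since $R$ is right noetherian, each module of cocycles is finitely generated. The free modules
cover all cocycles, not just cohomology classes, so no boundary correction is needed. -/
lemma exists_freeCx_elemSurjective (L : CxProj R) :
    ∃ (n : ℤ → ℕ) (q : freeCx R n ⟶ L), ElemSurjective q := by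
  have key : ∀ i, ∃ (n : ℕ) (q : freeObj R n ⟶ L.X i), q ≫ L.d i (i + 1) = 0 ∧
      ∀ x, lin (L.d i (i + 1)) x = 0 → ∃ y, lin q y = x := by
    intro i
    obtain ⟨n, π, hπ⟩ := Module.Finite.exists_fin' Rᵐᵒᵖ (LinearMap.ker (lin (L.d i (i + 1))))
    let e : (Fin n → R) ≃ₗ[Rᵐᵒᵖ] (Fin n → Rᵐᵒᵖ) :=
      LinearEquiv.piCongrRight fun _ => MulOpposite.opLinearEquiv Rᵐᵒᵖ (M := R)
    refine ⟨n, homOfLin (A := freeObj R n)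
      ((LinearMap.ker (lin (L.d i (i + 1)))).subtype ∘ₗ π ∘ₗ e.toLinearMap), ?_, ?_⟩
    · exact lin_injective fun x => (π (e x)).2
    · intro x hx
      obtain ⟨y, hy⟩ := hπ ⟨x, hx⟩
      refine ⟨e.symm y, ?_⟩
      have : (π (e (e.symm y))).1 = x := by rw [LinearEquiv.apply_symm_apply, hy]
      exact this
  choose n q hq hsurj using key
  refine ⟨n, { f := q, comm' := ?_ }, fun i x hx => ?_⟩
  · rintro i j (rfl : i + 1 = j)
    exact (hq i).trans zero_comp.symm
  · obtain ⟨y, hy⟩ := hsurj i x hx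
    exact ⟨y, 0, rfl, by rw [map_zero, add_zero]; exact hy.symm⟩

lemma exists_freeCx_cohSurjective (X : KProj R) :
    ∃ (n : ℤ → ℕ) (q : toK (freeCx R n) ⟶ X), CohSurjective q := by
  obtain ⟨L, rfl⟩ := HomotopyCategory.quotient_obj_surjective X
  obtain ⟨n, q, hq⟩ := exists_freeCx_elemSurjective L
  exact ⟨n, _, (cohSurjective_iff q).2 hq⟩

/-- A cohomologically surjective map from a complex in $\operatorname{Add}R$ factors through `p`,
forcing `p` to be surjective on cohomology. -/
lemma IsRightAddApproximation.cohSurjective {P X : KProj R} {p : P ⟶ X}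
    (hp : IsRightAddApproximation p) : CohSurjective p := by
  obtain ⟨n, q, hq⟩ := exists_freeCx_cohSurjective X
  obtain ⟨t, rfl⟩ := hp.2 _ (addR_freeCx n) q
  intro i x
  obtain ⟨y, hy⟩ := hq i x
  exact ⟨(cohomology R i).map t y, by rw [← hy, Functor.map_comp]; rfl⟩

/-- Lifting the identity of `P` through such a map exhibits `P` as a retract of a complex of free
modules with zero differential. -/
lemma AddR.gdimLE_coker {P : KProj R} (hP : AddR R P) (i : ℤ) : GdimLE R 0 (coker P i) := by
  obtain ⟨n, q, hq⟩ := exists_freeCx_cohSurjective P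
  obtain ⟨t, ht⟩ := hP.lifts _ _ q hq (𝟙 P)
  exact (gdimLE_coker_freeCx n i).coker_of_retract t q ht i

lemma exists_isSyzygy (X : KProj R) : ∃ Y, IsSyzygy X Y := by
  obtain ⟨n, q, hq⟩ := exists_freeCx_cohSurjective X
  obtain ⟨Y, a, h, hT⟩ := Pretriangulated.distinguished_cocone_triangle₁ q
  exact ⟨Y, _, a, q, h, hq.isRightAddApproximation (addR_freeCx n), hT⟩

end AddR

/-! ### Gorenstein dimension of complexes -/

section Main

variable {R : Type u} [Ring R] [IsNoetherianRing Rᵐᵒᵖ]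

section Triangle

variable {Y G X : KProj R} {a : Y ⟶ G} {f : G ⟶ X} {h : X ⟶ Y⟦(1 : ℤ)⟧}

lemma gdimLE_coker_right (hT : Pretriangulated.Triangle.mk a f h ∈ distTriang (KProj R))
    (hf : CohSurjective f) {n : ℕ} {i : ℤ} (hG : GdimLE R 0 (coker G i))
    (hY : GdimLE R n (coker Y i)) : GdimLE R (n + 1) (coker X i) := by
  obtain ⟨Z, ⟨e⟩, hZ⟩ := exists_isShortExact_coker hT hf
  obtain ⟨α, β, hαβ⟩ := hZ i
  exact (gdimLE_coker_iff_of_iso e i).2 (GdimLE.right hαβ hG.prod_projective hY)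

lemma gdimLE_coker_left (hT : Pretriangulated.Triangle.mk a f h ∈ distTriang (KProj R))
    (hf : CohSurjective f) {n : ℕ} {i : ℤ} (hG : GdimLE R 0 (coker G i))
    (hX : GdimLE R (n + 1) (coker X i)) : GdimLE R n (coker Y i) := by
  obtain ⟨Z, ⟨e⟩, hZ⟩ := exists_isShortExact_coker hT hf
  obtain ⟨α, β, hαβ⟩ := hZ i
  exact GdimLE.left hαβ hG.prod_projective ((gdimLE_coker_iff_of_iso e i).1 hX)

end Triangle

/-- This holds for every approximation, so the choices made in forming iterated syzygies do not
matter. -/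
lemma IsSyzygy.gdimLE_coker_iff {X Y : KProj R} (h : IsSyzygy X Y) (n : ℕ) (i : ℤ) :
    GdimLE R (n + 1) (coker X i) ↔ GdimLE R n (coker Y i) := by
  obtain ⟨P, a, p, δ, hp, hT⟩ := h
  exact ⟨gdimLE_coker_left hT hp.cohSurjective (hp.1.gdimLE_coker i),
    gdimLE_coker_right hT hp.cohSurjective (hp.1.gdimLE_coker i)⟩

lemma IsNthSyzygy.gdimLE_coker_iff {n : ℕ} {X Y : KProj R} (h : IsNthSyzygy n X Y) (m : ℕ)
    (i : ℤ) : GdimLE R (m + n) (coker X i) ↔ GdimLE R m (coker Y i) := by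
  induction n generalizing Y m with
  | zero =>
    obtain ⟨e⟩ := h
    exact (gdimLE_coker_iff_of_iso e i).symm
  | succ n ih =>
    obtain ⟨Z, hXZ, hZY⟩ := h
    rw [← hZY.gdimLE_coker_iff, ← ih hXZ, Nat.add_right_comm, Nat.add_assoc]

lemma exists_isNthSyzygy (n : ℕ) (X : KProj R) : ∃ Y, IsNthSyzygy n X Y := by
  induction n with
  | zero => exact ⟨X, ⟨Iso.refl X⟩⟩
  | succ n ih =>
    obtain ⟨Z, hZ⟩ := ih
    obtain ⟨Y, hY⟩ := exists_isSyzygy Z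
    exact ⟨Y, Z, hZ, hY⟩

variable [IsNoetherianRing R]

lemma isGorensteinProjectiveComplex_iff (X : KProj R) :
    IsGorensteinProjectiveComplex X ↔ ∀ i, GdimLE R 0 (coker X i) :=
  forall_congr' fun _ => (gdimLE_zero_iff _).symm

lemma HasGorensteinResolution.gdimLE_coker {n : ℕ} {X : KProj R}
    (h : HasGorensteinResolution n X) (i : ℤ) : GdimLE R n (coker X i) := by
  obtain ⟨Y, G, ⟨e⟩, hY, hG⟩ := h
  rw [← gdimLE_coker_iff_of_iso e i]
  induction n generalizing Y G X with
  | zero => exact (isGorensteinProjectiveComplex_iff _).1 hY i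
  | succ n ih =>
    obtain ⟨hG₀, a, f, δ, hT, hf⟩ := hG 0 (by lia)
    exact gdimLE_coker_right hT hf ((isGorensteinProjectiveComplex_iff _).1 hG₀ i)
      (ih (fun j => Y (j + 1)) (fun j => G (j + 1)) (Iso.refl _) hY
        fun j hj => hG (j + 1) (by lia))

lemma HasGorensteinResolution.of_gdimLE_coker {n : ℕ} {X : KProj R}
    (h : ∀ i, GdimLE R n (coker X i)) : HasGorensteinResolution n X := by
  induction n generalizing X with
  | zero =>
    exact ⟨fun _ => X, fun _ => X, ⟨Iso.refl X⟩, (isGorensteinProjectiveComplex_iff X).2 h,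
      fun i hi => absurd hi (Nat.not_lt_zero i)⟩
  | succ n ih =>
    obtain ⟨Z, hXZ⟩ := exists_isSyzygy X
    obtain ⟨Y, G, ⟨e⟩, hY, hG⟩ := ih fun i => (hXZ.gdimLE_coker_iff n i).1 (h i)
    obtain ⟨P, a, p, δ, hp, hT⟩ := hXZ
    refine ⟨fun j => Nat.casesOn j X Y, fun j => Nat.casesOn j P G, ⟨Iso.refl X⟩, hY, ?_⟩
    rintro (_ | j) hj
    -- The resolution of the syzygy starts at an object only isomorphic to it, so the first triangle
    -- is transported along `e`.
    · refine ⟨(isGorensteinProjectiveComplex_iff P).2 hp.1.gdimLE_coker, e.hom ≫ a, p,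
        δ ≫ e.inv⟦(1 : ℤ)⟧', ?_, hp.cohSurjective⟩
      refine Pretriangulated.isomorphic_distinguished _ hT _
        (Pretriangulated.Triangle.isoMk _ _ e (Iso.refl _) (Iso.refl _) ?_ ?_ ?_)
      · exact Category.comp_id _
      · exact (Category.comp_id _).trans (Category.id_comp _).symm
      · change (δ ≫ e.inv⟦(1 : ℤ)⟧') ≫ e.hom⟦(1 : ℤ)⟧' = 𝟙 _ ≫ δ
        rw [Category.assoc, ← Functor.map_comp, e.inv_hom_id, CategoryTheory.Functor.map_id, Category.comp_id,
          Category.id_comp]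
    · exact hG j (by lia)

lemma gdim_le_iff (X : KProj R) (n : ℕ) : Gdim X ≤ n ↔ ∀ i, GdimLE R n (coker X i) := by
  constructor
  · intro h i
    have hne : {m : ℕ∞ | ∃ n : ℕ, m = n ∧ HasGorensteinResolution n X}.Nonempty := by
      by_contra hempty
      rw [Set.not_nonempty_iff_eq_empty] at hempty
      rw [Gdim, hempty, sInf_empty] at h
      exact absurd (top_le_iff.1 h) (ENat.natCast_ne_top n)
    obtain ⟨m, hm, hres⟩ := csInf_mem hne
    refine (hres.gdimLE_coker i).mono ?_
    rw [Gdim, hm] at h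
    exact_mod_cast h
  · intro h
    exact sInf_le ⟨n, rfl, .of_gdimLE_coker h⟩

end Main

end GorensteinComplex

end

theorem theorem5p10 (R : Type u) [Ring R] [IsNoetherianRing R] [IsNoetherianRing Rᵐᵒᵖ]
    (X : GorensteinComplex.KProj R) :
    (∀ n : ℕ,
      (∃ Y : GorensteinComplex.KProj R, GorensteinComplex.IsNthSyzygy n X Y) ∧
      ∀ Y : GorensteinComplex.KProj R, GorensteinComplex.IsNthSyzygy n X Y →
        (GorensteinComplex.Gdim X ≤ (n : ℕ∞) ↔
          GorensteinComplex.IsGorensteinProjectiveComplex Y)) ∧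
    GorensteinComplex.Gdim X =
      ⨆ i : ℤ, GorensteinComplex.moduleGdim (GorensteinComplex.coker X i) := by
  refine ⟨fun n => ⟨GorensteinComplex.exists_isNthSyzygy n X, fun Y hY => ?_⟩, ?_⟩
  · rw [GorensteinComplex.gdim_le_iff, GorensteinComplex.isGorensteinProjectiveComplex_iff]
    refine forall_congr' fun i => ?_
    rw [← hY.gdimLE_coker_iff 0 i, Nat.zero_add]
  -- Both sides have the same upper bounds in `ℕ∞`: a finite bound on either one means that every
  -- $C^i(X)$ satisfies it.
  · refine eq_of_forall_ge_iff fun c => ?_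
    induction c using ENat.recTopCoe with
    | top => simp
    | coe n =>
      rw [GorensteinComplex.gdim_le_iff, iSup_le_iff]
      exact forall_congr' fun i => (GorensteinComplex.moduleGdim_le_iff _ n).symm
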